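/- **Conventions.** Let $k$ be a field of characteristic zero and $Q$ a quiver with finitely many vertices and finitely many arrows. Let $W=\sum_{n\ge 2}W_n$ be a potential, i.e. a formal (possibly infinite) $k$-linear combination of cyclic paths of length at least $2$, taken up to rotation, where $W_n$ is the part of length $n$; the *cycles of $W$* are the cyclic paths with nonzero coefficient. Let $\mathcal D=\mathcal D_r(Q,W)$ be the following $A_\infty$-category. Its objects are the vertices of $Q$. A homogeneous basis of its morphisms is given by the identities $1_x$ (degree $0$), for each arrow $a:x\to y$ an element $a^*\in\operatorname{Hom}^1(y,x)$ and an element $a\in\operatorname{Hom}^2(x,y)$, and for each vertex $x$ an element $\omega_x\in\operatorname{Hom}^3(x,x)$. Write $b_n$ for the compositions on shifted morphisms, $b_n\circ S^{\otimes n}=S\circ m_n$ with $S:\operatorname{Hom}\to\operatorname{Hom}[1]$ the shift (so $b_2(f,g)=(-1)^{|f|}m_2(f,g)$). The $1_x$ are strict units; for $a:x\to y$ one has $m_2(a^*,a)=\omega_x$ and $m_2(a,a^*)=\omega_y$; for $n\ge 1$ and a composable sequence of dual arrows, $b_n(a_n^*,\dots,a_1^*)$ is the contraction of $(a_n^*,\dots,a_1^*)$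 with $\mu(W_{n+1})$, that is $$b_n(a_n^*,\dots,a_1^*)=\sum_{a}\lambda_a\,a ,$$ where $\lambda_a$ is the coefficient in $\mu(W_{n+1})$ of the closed path traversing $a_n,a_{n-1},\dots,a_1,a$ in this order, and $\mu$ sends a cyclic path $c_1\cdots c_m$ to $\frac1m\sum_{j=1}^m c_j\cdots c_mc_1\cdots c_{j-1}$. All other compositions of basis elements vanish. Let $\langle\cdot,\cdot\rangle$ be the pairing of degree $-3$ with $\langle 1_x,\omega_x\rangle=\langle\omega_x,1_x\rangle=\langle a^*,a\rangle=\langle a,a^*\rangle=1$ and all other pairings of basis elements zero. For a $\mathcal D$-bimodule $M$ let $M^\vee=M^*[-3]$ be the shifted dual bimodule, $M^\vee(x,y)^d=(M(y,x)^{3-d})^*$, with structure maps $b_{M^\vee}(p,\varphi,q)(m)=(-1)^{\|p\|+\|m\|}\varphi(b_M(q,m,p))$, where $\|\cdot\|$ is the degree after shifting by one. A bimodule $L$ with a morphism $i:L\to\mathcal D$ to the diagonal bimodule is a *Lagrangian sub-bimodule* if there are a bimodule $N$ and a commutative diagram of strict morphisms of (strictly unital) $\mathcal D$-bimodules $$\begin{array}{ccccc}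 L&\xrightarrow{\ i\ }&\mathcal D&\xrightarrow{\ q\ }&N\\ {\scriptstyle\tau_L}\downarrow&&{\scriptstyle\tau}\downarrow&&\downarrow{\scriptstyle\tau_L^\vee}\\ N^\vee&\xrightarrow{\ q^\vee\ }&\mathcal D^\vee&\xrightarrow{\ i^\vee\ }&L^\vee\end{array}$$ whose rows are short exact sequences of the underlying graded spaces (for each pair of objects), whose columns are isomorphisms, and where $\tau(f)=\langle f,\cdot\rangle$. **Proposition.** $\mathcal D_r(Q,W)$ is a finite-dimensional, strictly unital $A_\infty$-category, and $\langle\cdot,\cdot\rangle$ is a Calabi–Yau structure of dimension $3$ on it. Let $T$ be a set of arrows of $Q$ such that no cycle of $W$ contains two different arrows of $T$ and no cycle of $W$ contains more than a single copy of an arrow of $T$. Then there is a Lagrangian sub-bimodule $L_T\subset\mathcal D_r(Q,W)$ whose underlying space is $$k\{\,a : a\notin T,\ \ a^* : a\in T\,\}\ \oplus\ \mathcal D_r(Q,W)^3 .$$ -/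

import Mathlib

universe u v w w' w₁ w₂ w₃

namespace AInf

/-! ### Composable sequences -/

/-- Composable sequences `(f_n, …, f_1)` of elements `f_i ∈ H x_{i-1} x_i`, read from left (last
applied) to right (first applied). `Chain H x y` are the sequences with `x_0 = x`, `x_n = y`. -/
inductive Chain {V : Type u} (H : V → V → Type w) : V → V → Type (max u w)
  | nil (x : V) : Chain H x x
  | cons {x y z : V} (f : H y z) (p : Chain H x y) : Chain H x z

/-- Concatenation, the left factor being the one applied last. -/
def Chain.append {V : Type u} {H : V → V → Type w} {x y : V} :
    {z : V} → Chain H y z → Chain H x y → Chain H x z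
  | _, .nil _, q => q
  | _, .cons f p, q => .cons f (p.append q)

/-- The number of entries of a composable sequence. -/
def Chain.length {V : Type u} {H : V → V → Type w} {x : V} : {y : V} → Chain H x y → ℕ
  | _, .nil _ => 0
  | _, .cons _ p => p.length + 1

/-- All the ways of cutting a composable sequence `p` into a left and a right piece,
`p = p'.append p''` (both pieces may be empty). -/
def Chain.splits {V : Type u} {H : V → V → Type w} {x : V} :
    {y : V} → Chain H x y → List (Σ z : V, Chain H z y × Chain H x z)
  | _, .nil _ => [⟨x, .nil x, .nil x⟩]
  | z, .cons f p =>
      ⟨z, .nil z, .cons f p⟩ :: p.splits.map fun s => ⟨s.1, .cons f s.2.1, s.2.2⟩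

/-! ### Graded vector spaces indexed by pairs of objects -/

/-- The sign `(-1)^n` as an element of `k`. -/
def sgn (k : Type w) [Ring k] (n : ℤ) : k := ((Int.negOnePow n : ℤ) : k)

/-- A family of `ℤ`-graded `k`-vector spaces indexed by ordered pairs of objects: `obj x y d` is the
part of degree `d`. This is the same thing as a graded bimodule over the category with objects `V`
whose only morphisms are the multiples of identities. -/
structure GradedFamily (k : Type w) [Field k] (V : Type u) where
  obj : V → V → ℤ → Type w'
  [acg : ∀ x y d, AddCommGroup (obj x y d)]
  [mod : ∀ x y d, Module k (obj x y d)]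

attribute [instance] GradedFamily.acg GradedFamily.mod

section Graded

variable {k : Type w} [Field k] {V : Type u}

/-- Homogeneous elements, together with their degree. -/
abbrev GradedFamily.El (M : GradedFamily.{u, w, w'} k V) (x y : V) : Type w' :=
  Σ d : ℤ, M.obj x y d

/-- The total degree of a composable sequence of homogeneous elements of the shifted family `M[1]`:
an element of degree `d` counts as `d - 1`. -/
def GradedFamily.sdeg (M : GradedFamily.{u, w, w'} k V) {x : V} : {y : V} → Chain M.El x y → ℤ
  | _, .nil _ => 0
  | _, .cons f p => (f.1 - 1) + M.sdeg p

/-- Degree zero linear maps between graded families (with the same indexing objects). -/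
abbrev GrMap (M : GradedFamily.{u, w, w₁} k V) (N : GradedFamily.{u, w, w₂} k V) :=
  ∀ (x y : V) (d : ℤ), M.obj x y d →ₗ[k] N.obj x y d

/-- Rewriting the degree along an equality of integers. -/
def GradedFamily.degCast (M : GradedFamily.{u, w, w'} k V) {x y : V} {d e : ℤ} (h : d = e) :
    M.obj x y d ≃ₗ[k] M.obj x y e := by
  subst h; exact LinearEquiv.refl k _

/-- The operation `M ↦ M^∨ = M^*[-3]` on graded families: `M^∨(x, y)` is the graded dual of
`M(y, x)`, shifted so that its part of degree `d` is the dual of the part of degree `3 - d`. -/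
def GradedFamily.dual (M : GradedFamily.{u, w, w'} k V) : GradedFamily.{u, w, max w w'} k V where
  obj x y d := Module.Dual k (M.obj y x (3 - d))

/-- The transpose `f^∨ : N^∨ → M^∨`, `φ ↦ φ ∘ f`, of `f : M → N`. -/
def GrMap.dual {M : GradedFamily.{u, w, w₁} k V} {N : GradedFamily.{u, w, w₂} k V}
    (f : GrMap M N) : GrMap N.dual M.dual :=
  fun x y d => (f y x (3 - d)).dualMap

/-- The canonical map `M → M^∨^∨`, `m ↦ (φ ↦ φ m)`. -/
def GradedFamily.toDoubleDual (M : GradedFamily.{u, w, w'} k V) : GrMap M M.dual.dual :=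
  fun x y d => (Module.Dual.eval k (M.obj x y (3 - (3 - d)))).comp
    (M.degCast (show d = 3 - (3 - d) by ring)).toLinearMap

/-- `0 → L → M → N → 0` is exact (in every degree and for every pair of objects). -/
def ShortExact {L : GradedFamily.{u, w, w₁} k V} {M : GradedFamily.{u, w, w₂} k V}
    {N : GradedFamily.{u, w, w₃} k V} (i : GrMap L M) (q : GrMap M N) : Prop :=
  ∀ x y d, Function.Injective (i x y d) ∧ Function.Surjective (q x y d) ∧
    LinearMap.range (i x y d) = LinearMap.ker (q x y d)

/-! ### `A_∞`-categories

Compositions are written through the maps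
`b_n : Hom(x_{n-1}, x_n)[1] ⊗ … ⊗ Hom(x_0, x_1)[1] → Hom(x_0, x_n)[1]` of degree `1`, which are
related to the compositions `m_n` of degree `2 - n` by `b_n ∘ S^{⊗n} = S ∘ m_n`, where
`S : Hom → Hom[1]` is the shift. In particular `b_2(f, g) = (-1)^{|f|} m_2(f, g)`. All signs are
those of the Koszul rule in the shifted degrees `|f| - 1`. -/

/-- The data underlying a `k`-linear unital `A_∞`-category with set of objects `V`: graded spaces of
morphisms, degree zero elements `one x`, and multilinear operations `b`. The component of `b p` in
degree `e` is `b p e`. No relation is imposed yet. -/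
structure AInfData (k : Type w) [Field k] (V : Type u) extends GradedFamily.{u, w, w'} k V where
  one : ∀ x, obj x x 0
  b : ∀ {x y : V}, Chain (fun x y => Σ d : ℤ, obj x y d) x y → ∀ e : ℤ, obj x y e
  b_add : ∀ {x y z t : V} (p : Chain (fun x y => Σ d : ℤ, obj x y d) z t) (d : ℤ)
    (f g : obj y z d) (q : Chain (fun x y => Σ d : ℤ, obj x y d) x y) (e : ℤ),
    b (p.append (.cons ⟨d, f + g⟩ q)) e =
      b (p.append (.cons ⟨d, f⟩ q)) e + b (p.append (.cons ⟨d, g⟩ q)) e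
  b_smul : ∀ {x y z t : V} (p : Chain (fun x y => Σ d : ℤ, obj x y d) z t) (d : ℤ)
    (c : k) (f : obj y z d) (q : Chain (fun x y => Σ d : ℤ, obj x y d) x y) (e : ℤ),
    b (p.append (.cons ⟨d, c • f⟩ q)) e = c • b (p.append (.cons ⟨d, f⟩ q)) e

/-- The value of `b` on a composable sequence `p`, as a homogeneous element of the degree which is
forced by the requirement that `b` has degree `1` in the shifted grading. -/
def AInfData.bEl (C : AInfData.{u, w, w'} k V) {x y : V} (p : Chain C.El x y) : C.El x y :=
  ⟨C.sdeg p + 2, C.b p (C.sdeg p + 2)⟩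

/-- The `A_∞`-expression `∑ b_{a+1+c}(id^{⊗a} ⊗ b_n ⊗ id^{⊗c})`, evaluated on `p`: the sum over all
`p = p₁.append (p₂.append p₃)` of `(-1)^{‖p₁‖} b(p₁, b(p₂), p₃)`. -/
def AInfData.relation (C : AInfData.{u, w, w'} k V) {x y : V} (p : Chain C.El x y) (e : ℤ) :
    C.obj x y e :=
  (p.splits.map fun s => (s.2.2.splits.map fun t =>
    sgn k (C.sdeg s.2.1) • C.b (s.2.1.append (.cons (C.bEl t.2.1) t.2.2)) e).sum).sum

/-- The axioms of a strictly unital `A_∞`-category. -/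
structure AInfData.IsAInfCategory (C : AInfData.{u, w, w'} k V) : Prop where
  /-- there is no operation without inputs -/
  nil : ∀ x e, C.b (.nil x) e = 0
  /-- the operations have degree `1` in the shifted grading -/
  degree : ∀ {x y : V} (p : Chain C.El x y) (e : ℤ), e ≠ C.sdeg p + 2 → C.b p e = 0
  /-- the `A_∞`-relations -/
  relation : ∀ {x y : V} (p : Chain C.El x y) (e : ℤ), C.relation p e = 0
  /-- `m_2(1, f) = f` -/
  one_left : ∀ {x y : V} (d : ℤ) (f : C.obj x y d),
    C.b (.cons ⟨0, C.one y⟩ (.cons ⟨d, f⟩ (.nil x))) d = f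
  /-- `m_2(f, 1) = f` -/
  one_right : ∀ {x y : V} (d : ℤ) (f : C.obj x y d),
    C.b (.cons ⟨d, f⟩ (.cons ⟨0, C.one x⟩ (.nil x))) d = sgn k d • f
  /-- the other operations vanish as soon as one of the inputs is a unit -/
  one_vanish : ∀ {x y z : V} (p : Chain C.El y z) (q : Chain C.El x y) (e : ℤ),
    p.length + q.length ≠ 1 → C.b (p.append (.cons ⟨0, C.one y⟩ q)) e = 0

/-- Finite-dimensionality: finitely many objects, and finite-dimensional total morphism spaces. -/
def AInfData.IsFiniteDimensional (C : AInfData.{u, w, w'} k V) : Prop :=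
  Finite V ∧ ∀ x y, (∀ d, FiniteDimensional k (C.obj x y d)) ∧
    {d : ℤ | Nontrivial (C.obj x y d)}.Finite

/-! ### Calabi–Yau structures of dimension 3 -/

/-- Bilinear forms `⟨·,·⟩ : Hom(x, y) ⊗ Hom(y, x) → k`, given on homogeneous elements. -/
abbrev Pairing (C : AInfData.{u, w, w'} k V) :=
  ∀ (x y : V) (d e : ℤ), C.obj x y d →ₗ[k] C.obj y x e →ₗ[k] k

/-- The functional `⟨·,·⟩ ∘ (b ⊗ id)` on `Hom[1] ⊗ … ⊗ Hom[1]`, evaluated on `(p, f)`. The form is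
evaluated on shifted elements, which produces the Koszul sign `(-1)^{|b p|}`. -/
def Pairing.cyc {C : AInfData.{u, w, w'} k V} (P : Pairing C) {x y : V} (p : Chain C.El x y)
    (f : C.El y x) : k :=
  sgn k (C.sdeg p + 2) * P x y (C.sdeg p + 2) f.1 (C.b p (C.sdeg p + 2)) f.2

/-- The axioms of a 3-dimensional Calabi–Yau structure. -/
structure Pairing.IsCalabiYau {C : AInfData.{u, w, w'} k V} (P : Pairing C) : Prop where
  /-- the form takes values in `k[-3]` -/
  degree : ∀ x y d e, d + e ≠ 3 → P x y d e = 0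
  /-- graded symmetry -/
  symm : ∀ x y d e (f : C.obj x y d) (g : C.obj y x e),
    P x y d e f g = sgn k (d * e) * P y x e d g f
  /-- nondegeneracy -/
  nondegenerate : ∀ x y d (f : C.obj x y d), (∀ g, P x y d (3 - d) f g = 0) → f = 0
  /-- cyclic invariance: moving the leftmost entry to the right end costs the Koszul sign -/
  cyclic : ∀ {x y z : V} (f : C.El y z) (p : Chain C.El x y) (g : C.El z x),
    P.cyc (.cons f p) g =
      sgn k ((f.1 - 1) * (C.sdeg p + (g.1 - 1))) * P.cyc (p.append (.cons g (.nil z))) f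

/-! ### Bimodules over `A_∞`-categories -/

/-- The data underlying a bimodule `M` over `C`. As for the diagonal bimodule, `obj y x` behaves like
a space of morphisms from `y` to `x`; `act p q d e m` is the component in degree `e` of `b_M(p, m, q)`
for `m` of degree `d`. -/
structure BimodData (C : AInfData.{u, w, w'} k V) extends GradedFamily.{u, w, w₁} k V where
  act : ∀ {x x' y y' : V}, Chain C.El x x' → Chain C.El y' y → ∀ d e : ℤ,
    obj y x d →ₗ[k] obj y' x' e

/-- The value `b_M(p, m, q)`, as a homogeneous element of the degree which is forced by the
requirement that `b_M` has degree `1` in the shifted grading. -/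
def BimodData.actEl {C : AInfData.{u, w, w'} k V} (M : BimodData.{u, w, w', w₁} C) {x x' y y' : V}
    (p : Chain C.El x x') (q : Chain C.El y' y) (m : M.El y x) : M.El y' x' :=
  ⟨C.sdeg p + m.1 + C.sdeg q + 1, M.act p q m.1 (C.sdeg p + m.1 + C.sdeg q + 1) m.2⟩

/-- The bimodule expression, evaluated on `(p, m, q)`: the sum of all
`± b_M(p₁, b(p₂), p₃, m, q)`, `± b_M(p₁, b_M(p₂, m, q₁), q₂)` and `± b_M(p, m, q₁, b(q₂), q₃)`,
with the sign `(-1)^r` for `r` the total shifted degree of the entries left of the inner `b`. -/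
def BimodData.relation {C : AInfData.{u, w, w'} k V} (M : BimodData.{u, w, w', w₁} C)
    {x x' y y' : V} (p : Chain C.El x x') (m : M.El y x) (q : Chain C.El y' y) (e : ℤ) :
    M.obj y' x' e :=
  (p.splits.map fun s => (s.2.2.splits.map fun t =>
    sgn k (C.sdeg s.2.1) •
      M.act (s.2.1.append (.cons (C.bEl t.2.1) t.2.2)) q m.1 e m.2).sum).sum
  + (p.splits.map fun s => (q.splits.map fun t =>
      sgn k (C.sdeg s.2.1) •
        M.act s.2.1 t.2.2 _ e (M.actEl s.2.2 t.2.1 m).2).sum).sum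
  + (q.splits.map fun s => (s.2.2.splits.map fun t =>
      sgn k (C.sdeg p + (m.1 - 1) + C.sdeg s.2.1) •
        M.act p (s.2.1.append (.cons (C.bEl t.2.1) t.2.2)) m.1 e m.2).sum).sum

/-- The axioms of a strictly unital `A_∞`-bimodule. -/
structure BimodData.IsBimodule {C : AInfData.{u, w, w'} k V} (M : BimodData.{u, w, w', w₁} C) :
    Prop where
  left_add : ∀ {x x' y y' z z' : V} (p : Chain C.El z' x') (a : ℤ) (f g : C.obj z z' a)
    (p' : Chain C.El x z) (q : Chain C.El y' y) (d e : ℤ),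
    M.act (p.append (.cons ⟨a, f + g⟩ p')) q d e =
      M.act (p.append (.cons ⟨a, f⟩ p')) q d e + M.act (p.append (.cons ⟨a, g⟩ p')) q d e
  left_smul : ∀ {x x' y y' z z' : V} (p : Chain C.El z' x') (a : ℤ) (c : k) (f : C.obj z z' a)
    (p' : Chain C.El x z) (q : Chain C.El y' y) (d e : ℤ),
    M.act (p.append (.cons ⟨a, c • f⟩ p')) q d e = c • M.act (p.append (.cons ⟨a, f⟩ p')) q d e
  right_add : ∀ {x x' y y' z z' : V} (p : Chain C.El x x') (q : Chain C.El z' y) (a : ℤ)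
    (f g : C.obj z z' a) (q' : Chain C.El y' z) (d e : ℤ),
    M.act p (q.append (.cons ⟨a, f + g⟩ q')) d e =
      M.act p (q.append (.cons ⟨a, f⟩ q')) d e + M.act p (q.append (.cons ⟨a, g⟩ q')) d e
  right_smul : ∀ {x x' y y' z z' : V} (p : Chain C.El x x') (q : Chain C.El z' y) (a : ℤ)
    (c : k) (f : C.obj z z' a) (q' : Chain C.El y' z) (d e : ℤ),
    M.act p (q.append (.cons ⟨a, c • f⟩ q')) d e = c • M.act p (q.append (.cons ⟨a, f⟩ q')) d e
  /-- the operations have degree `1` in the shifted grading -/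
  degree : ∀ {x x' y y' : V} (p : Chain C.El x x') (q : Chain C.El y' y) (d e : ℤ),
    e ≠ C.sdeg p + d + C.sdeg q + 1 → M.act p q d e = 0
  /-- the bimodule relations -/
  relation : ∀ {x x' y y' : V} (p : Chain C.El x x') (m : M.El y x) (q : Chain C.El y' y) (e : ℤ),
    M.relation p m q e = 0
  /-- units act as identities -/
  one_left : ∀ (x y : V) (d : ℤ) (m : M.obj y x d),
    M.act (.cons ⟨0, C.one x⟩ (.nil x)) (.nil y) d d m = m
  one_right : ∀ (x y : V) (d : ℤ) (m : M.obj y x d),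
    M.act (.nil x) (.cons ⟨0, C.one y⟩ (.nil y)) d d m = sgn k d • m
  /-- all other operations vanish as soon as one of the morphisms is a unit -/
  one_vanish_left : ∀ {x x' y y' z : V} (p : Chain C.El z x') (p' : Chain C.El x z)
    (q : Chain C.El y' y) (d e : ℤ), 1 ≤ p.length + p'.length + q.length →
    M.act (p.append (.cons ⟨0, C.one z⟩ p')) q d e = 0
  one_vanish_right : ∀ {x x' y y' z : V} (p : Chain C.El x x') (q : Chain C.El z y)
    (q' : Chain C.El y' z) (d e : ℤ), 1 ≤ p.length + q.length + q'.length →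
    M.act p (q.append (.cons ⟨0, C.one z⟩ q')) d e = 0

/-- The diagonal bimodule: `C` itself, acted upon by its compositions. -/
def AInfData.diag (C : AInfData.{u, w, w'} k V) : BimodData.{u, w, w', w'} C where
  toGradedFamily := C.toGradedFamily
  act p q d e :=
    { toFun := fun m => C.b (p.append (.cons ⟨d, m⟩ q)) e
      map_add' := fun f g => C.b_add p d f g q e
      map_smul' := fun c f => C.b_smul p d c f q e }

/-- The dual bimodule `M^∨ = M^*[-3]`, with
`b_{M^∨}(p, φ, q)(m) = (-1)^{‖p‖ + ‖m‖} φ (b_M(q, m, p))`, where `‖·‖` is the shifted degree. -/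
def BimodData.dual {C : AInfData.{u, w, w'} k V} (M : BimodData.{u, w, w', w₁} C) :
    BimodData.{u, w, w', max w w₁} C where
  toGradedFamily := M.toGradedFamily.dual
  act p q d e := sgn k (C.sdeg p + ((3 - e) - 1)) • (M.act q p (3 - e) (3 - d)).dualMap

/-- A strict morphism of bimodules: a degree zero map commuting with all the operations. -/
def IsStrictMor {C : AInfData.{u, w, w'} k V} (M : BimodData.{u, w, w', w₁} C)
    (N : BimodData.{u, w, w', w₂} C) (f : GrMap M.toGradedFamily N.toGradedFamily) : Prop :=
  ∀ {x x' y y' : V} (p : Chain C.El x x') (q : Chain C.El y' y) (d e : ℤ) (m : M.obj y x d),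
    f y' x' e (M.act p q d e m) = N.act p q d e (f y x d m)

/-- A strict isomorphism of bimodules. -/
def IsStrictIso {C : AInfData.{u, w, w'} k V} (M : BimodData.{u, w, w', w₁} C)
    (N : BimodData.{u, w, w', w₂} C) (f : GrMap M.toGradedFamily N.toGradedFamily) : Prop :=
  IsStrictMor M N f ∧ ∀ x y d, Function.Bijective (f x y d)

/-- The map `τ : C → C^∨`, `f ↦ ⟨f, ·⟩`. -/
def Pairing.tau {C : AInfData.{u, w, w'} k V} (P : Pairing C) :
    GrMap C.diag.toGradedFamily C.diag.dual.toGradedFamily :=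
  fun x y d => P x y d (3 - d)

/-- A bimodule `L` over the Calabi–Yau category `(C, P)`, with `i : L → C`, is a Lagrangian
sub-bimodule if it fits into a commutative diagram of strict morphisms of bimodules

`  L   --i-->   C   --q-->   N  `
`  |            |            |  `
` N^∨ -q^∨-> C^∨ -i^∨-> L^∨ `

with columns `τ_L`, `τ = ⟨·, ·⟩` and the transpose of `τ_L`, in which the rows are short exact
sequences of underlying graded spaces and the columns are isomorphisms. -/
def IsLagrangian {C : AInfData.{u, w, w'} k V} (P : Pairing C) (L : BimodData.{u, w, w', w₁} C)
    (i : GrMap L.toGradedFamily C.diag.toGradedFamily) : Prop :=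
  L.IsBimodule ∧ ∃ (N : BimodData.{u, w, w', w₁} C)
    (q : GrMap C.diag.toGradedFamily N.toGradedFamily)
    (τL : GrMap L.toGradedFamily N.dual.toGradedFamily)
    (τN : GrMap N.toGradedFamily L.dual.toGradedFamily),
    N.IsBimodule ∧
    -- the rows
    IsStrictMor L C.diag i ∧ IsStrictMor C.diag N q ∧ ShortExact i q ∧
    IsStrictMor N.dual C.diag.dual (GrMap.dual q) ∧ IsStrictMor C.diag.dual L.dual (GrMap.dual i) ∧
    ShortExact (GrMap.dual q) (GrMap.dual i) ∧
    -- the columns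
    IsStrictIso L N.dual τL ∧ IsStrictIso C.diag C.diag.dual P.tau ∧ IsStrictIso N L.dual τN ∧
    (∀ x y d, τN x y d = (GrMap.dual τL x y d).comp (N.toDoubleDual x y d)) ∧
    -- the squares
    (∀ x y d, (GrMap.dual q x y d).comp (τL x y d) = (P.tau x y d).comp (i x y d)) ∧
    (∀ x y d, (τN x y d).comp (q x y d) = (GrMap.dual i x y d).comp (P.tau x y d))

end Graded

/-! ### The Calabi–Yau category of a quiver with potential -/

section QP

open scoped Classical

/-- A potential on a quiver: a formal (possibly infinite) `k`-linear combination of cyclic paths of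
length at least two, a cyclic path being considered up to rotation. The arrows of a cyclic path are
listed in the order in which they are traversed. -/
structure Potential (k : Type w) [Field k] (V : Type u) [Quiver.{v} V] where
  coeff : Cycle (Quiver.Total V) → k
  closed : ∀ c, coeff c ≠ 0 → c.Chain fun a b => a.right = b.left
  two_le_length : ∀ c, coeff c ≠ 0 → 2 ≤ c.length

variable {k : Type w} [Field k] {V : Type u} [Quiver.{v} V]

/-- The coefficient of the path `l` in `μ(W)`, where `μ` is the linear map
`a_1 … a_m ↦ (1/m) (a_1 … a_m + a_2 … a_m a_1 + … + a_m a_1 … a_{m-1})`. -/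
noncomputable def Potential.mu (W : Potential k V) (l : List (Quiver.Total V)) : k :=
  W.coeff (l : Cycle (Quiver.Total V)) * ((l.cyclicPermutations.count l : k) / (l.length : k))

/-- The basis of the morphisms `x → y`: the identities, the dual `a^* : y → x` of each arrow
`a : x ⟶ y`, each arrow `a : x ⟶ y`, and the classes `ω_x`. -/
inductive Gen (V : Type u) [Quiver.{v} V] : V → V → Type (max u v)
  | one (x : V) : Gen V x x
  | star {x y : V} (a : x ⟶ y) : Gen V y x
  | arr {x y : V} (a : x ⟶ y) : Gen V x y
  | omega (x : V) : Gen V x x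

/-- The degrees of the basis elements. -/
def Gen.deg {x y : V} : Gen V x y → ℤ
  | .one _ => 0
  | .star _ => 1
  | .arr _ => 2
  | .omega _ => 3

/-- The basis element which is dual for the Calabi–Yau pairing. -/
def Gen.swap {x y : V} : Gen V x y → Gen V y x
  | .one x => .omega x
  | .star a => .arr a
  | .arr a => .star a
  | .omega x => .one x

/-- The coefficient of `h` in the part of `b_2(f, g)` which does not depend on the potential:
`m_2(1, g) = g`, `m_2(f, 1) = f`, and `m_2(a^*, a) = ω = m_2(a, a^*)` for an arrow `a`;
recall that `b_2(f, g) = (-1)^{|f|} m_2(f, g)`. -/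
noncomputable def Gen.comp {x y z : V} : Gen V y z → Gen V x y → Gen V x z → k
  | .one _, g, h => if h = g then 1 else 0
  | f, .one _, h => if h = f then sgn k f.deg else 0
  | .star a, .arr a', .omega _ => if a' = a then -1 else 0
  | .arr a, .star a', .omega _ => if a' = a then 1 else 0
  | _, _, _ => 0

/-- The list of arrows `[a_n, …, a_1]` if the given sequence is `(a_n^*, …, a_1^*)`. This is a path
with `a_n` traversed first. -/
def Gen.word {x : V} : {y : V} → Chain (Gen V) x y → Option (List (Quiver.Total V))
  | _, .nil _ => some []
  | _, .cons (.star a) p => (Gen.word p).map (⟨_, _, a⟩ :: ·)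
  | _, .cons _ _ => none

/-- The coefficient of `h` in the contraction of the potential with the sequence `p`: for an arrow
`h = a`, the coefficient of `a` in `(a_n^*, …, a_1^*) μ(W)`. -/
noncomputable def Potential.contract (W : Potential k V) {x y : V} :
    Chain (Gen V) x y → Gen V x y → k
  | p, .arr a => match Gen.word p with
    | some l => W.mu (l ++ [⟨_, _, a⟩])
    | none => 0
  | _, _ => 0

/-- The coefficient of `h` in `b p`, for a composable sequence `p` of basis elements. -/
noncomputable def Potential.structureCoeff (W : Potential k V) {x y : V} :
    Chain (Gen V) x y → Gen V x y → k
  | .cons f (.cons g (.nil _)), h =>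
      Gen.comp f g h + W.contract (.cons f (.cons g (.nil _))) h
  | p, h => W.contract p h

/-- The degree `d` morphisms `x → y`: the vector space on the basis elements of degree `d`. -/
abbrev GenSpace (k : Type w) [Field k] {V : Type u} [Quiver.{v} V] (x y : V) (d : ℤ) :
    Type (max u v w) :=
  {g : Gen V x y // g.deg = d} →₀ k

/-- Multilinear extension of a function on composable sequences of basis elements. -/
noncomputable def multExt {x : V} : {y : V} →
    Chain (fun x y : V => Σ d : ℤ, GenSpace k x y d) x y → (Chain (Gen V) x y → k) → k
  | _, .nil _, F => F (.nil x)
  | _, .cons v p, F => multExt p fun q => v.2.sum fun g c => c * F (.cons g.1 q)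

theorem multExt_add_fun {x y : V} (p : Chain (fun x y : V => Σ d : ℤ, GenSpace k x y d) x y)
    (F G : Chain (Gen V) x y → k) :
    multExt p (fun q => F q + G q) = multExt p F + multExt p G := by
  induction p with
  | nil => rfl
  | cons v p ih => simp only [multExt, mul_add, Finsupp.sum_add, ih]

theorem multExt_smul_fun {x y : V} (p : Chain (fun x y : V => Σ d : ℤ, GenSpace k x y d) x y)
    (c : k) (F : Chain (Gen V) x y → k) :
    multExt p (fun q => c * F q) = c * multExt p F := by
  induction p with
  | nil => rfl
  | cons v p ih => simp only [multExt, mul_left_comm _ c, ← Finsupp.mul_sum, ih]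

theorem multExt_add {x y z t : V} (p : Chain (fun x y : V => Σ d : ℤ, GenSpace k x y d) z t)
    (d : ℤ) (f g : GenSpace k y z d)
    (q : Chain (fun x y : V => Σ d : ℤ, GenSpace k x y d) x y) (F : Chain (Gen V) x t → k) :
    multExt (p.append (.cons ⟨d, f + g⟩ q)) F =
      multExt (p.append (.cons ⟨d, f⟩ q)) F + multExt (p.append (.cons ⟨d, g⟩ q)) F := by
  induction p with
  | nil =>
    simp only [Chain.append, multExt, ← multExt_add_fun]
    congr 1; funext r
    exact Finsupp.sum_add_index' (fun _ => zero_mul _) fun _ _ _ => add_mul _ _ _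
  | cons v p ih => simp only [Chain.append, multExt, ih]

theorem multExt_smul {x y z t : V} (p : Chain (fun x y : V => Σ d : ℤ, GenSpace k x y d) z t)
    (d : ℤ) (c : k) (f : GenSpace k y z d)
    (q : Chain (fun x y : V => Σ d : ℤ, GenSpace k x y d) x y) (F : Chain (Gen V) x t → k) :
    multExt (p.append (.cons ⟨d, c • f⟩ q)) F = c * multExt (p.append (.cons ⟨d, f⟩ q)) F := by
  induction p with
  | nil =>
    simp only [Chain.append, multExt, ← multExt_smul_fun]
    congr 1; funext r
    rw [Finsupp.sum_smul_index' (fun _ => zero_mul _), Finsupp.mul_sum]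
    simp only [smul_eq_mul, mul_assoc]
  | cons v p ih => simp only [Chain.append, multExt, ih]

instance Gen.finite [∀ x y : V, Finite (x ⟶ y)] (x y : V) : Finite (Gen V x y) := by
  let F : Gen V x y → Unit ⊕ (y ⟶ x) ⊕ (x ⟶ y) ⊕ Unit := fun g => match g with
    | .one _ => .inl ()
    | .star a => .inr (.inl a)
    | .arr a => .inr (.inr (.inl a))
    | .omega _ => .inr (.inr (.inr ()))
  refine Finite.of_injective F fun g h e => ?_
  cases g <;> cases h <;> simp_all [F]

/-- The category `D_r(Q, W)`. Objects are the vertices of the quiver, and the morphisms `x → y` have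
the basis `Gen V x y`: in degree 0 the identities, in degree 1 the dual `a^*` of each arrow
`a : y ⟶ x`, in degree 2 each arrow `x ⟶ y`, and in degree 3 an endomorphism `ω_x` of each vertex. -/
noncomputable def Dr [∀ x y : V, Finite (x ⟶ y)] (W : Potential k V) :
    AInfData.{u, w, max u v w} k V where
  obj x y d := GenSpace k x y d
  one x := Finsupp.single ⟨.one x, rfl⟩ 1
  b p e := Finsupp.equivFunOnFinite.symm fun h => multExt p fun q => W.structureCoeff q h.1
  b_add p d f g q e := by ext h; simp [multExt_add]
  b_smul p d c f q e := by ext h; simp [multExt_smul]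

/-- The Calabi–Yau pairing of `D_r(Q, W)`: `⟨1, ω⟩ = ⟨ω, 1⟩ = 1` at each vertex and
`⟨a^*, a⟩ = ⟨a, a^*⟩ = 1` for each arrow, all other pairings of basis elements being zero. -/
noncomputable def drPairing [∀ x y : V, Finite (x ⟶ y)] (W : Potential k V) : Pairing (Dr W) :=
  fun x y d e => (Finsupp.linearCombination k fun g : {g : Gen V x y // g.deg = d} =>
    Finsupp.linearCombination k fun h : {h : Gen V y x // h.deg = e} =>
      if h.1 = g.1.swap then (1 : k) else 0 :
    GenSpace k x y d →ₗ[k] GenSpace k y x e →ₗ[k] k)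

/-- The basis elements spanning `L_T`: the arrows outside `T`, the duals of the arrows in `T`, and
all the `ω_x`. -/
def Gen.InL (T : Set (Quiver.Total V)) {x y : V} : Gen V x y → Prop
  | .one _ => False
  | .star a => ⟨_, _, a⟩ ∈ T
  | .arr a => ⟨_, _, a⟩ ∉ T
  | .omega _ => True

/-- The degree `d` part of `k{a : a ∉ T, a^* : a ∈ T} ⊕ D_r(Q, W)^3`, in the morphisms `x → y`. -/
noncomputable def lagSpace [∀ x y : V, Finite (x ⟶ y)] (W : Potential k V)
    (T : Set (Quiver.Total V)) (x y : V) (d : ℤ) : Submodule k ((Dr W).obj x y d) :=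
  (Submodule.span k {v | ∃ g : {g : Gen V x y // g.deg = d}, g.1.InL T ∧ v = Finsupp.single g 1} :
    Submodule k (GenSpace k x y d))

/-- No cycle of `W` contains two different arrows of `T`, and no cycle of `W` contains more than a
single copy of an arrow of `T`. -/
def Potential.MeetsAtMostOnce (W : Potential k V) (T : Set (Quiver.Total V)) : Prop :=
  ∀ c : Cycle (Quiver.Total V), W.coeff c ≠ 0 →
    (∀ a ∈ T, ∀ b ∈ T, a ∈ c → b ∈ c → a = b) ∧ ∀ a ∈ T, c.toMultiset.count a ≤ 1

end QP
end AInf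

/-!
# The Calabi–Yau category of a quiver with potential and its Lagrangian sub-bimodules

All three claims come down to two properties of the coefficients of the operations on the basis
`1_x, a^*, a, ω_x`.

* Cyclic invariance of `μ(W)` (`Potential.mu_rotate`, `Potential.structureCoeff_cyclic`). Both the
  `A_∞`-relations and the cyclic invariance of the pairing are consequences. The relations are
  multilinear, hence may be checked on basis vectors (`relation_of_basisChain`). If one of these is
  an identity, the relation is a formal consequence of strict unitality (`AInfData.relation_unit`).
  Otherwise an operation takes values in the span of the arrows and the `ω_x`, so that the outer
  operation must be one of the products `m_2(a^*, a)`, `m_2(a, a^*)`; just two terms remain, namely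
  `± λ ω` with `λ` the coefficients in `μ(W)` of two closed paths that differ by a rotation
  (`relation_basisChain_of_noOne`).

* If a contraction of `W` has an input `a^*` with `a ∈ T`, then no arrow of `T` occurs in its output,
  since that arrow and `a` would lie on one cycle of `W` (`Potential.structureCoeff_of_inL`). Hence
  the subspace in question is closed under all bimodule operations.

The rest is formal. Cyclic invariance makes `τ` a strict morphism `C → C^∨`
(`Pairing.IsCalabiYau.tau_strict`), and any closed family of subspaces that is its own orthogonal
complement is a Lagrangian sub-bimodule, `N` being the quotient bimodule (`isLagrangian_subι`). The
subspace is self-orthogonal because the involution of the basis defined by the pairing exchanges the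
basis elements inside and outside of it.
-/

namespace AInf

/-! ### Composable sequences -/

namespace Chain

variable {V : Type u} {H : V → V → Type w}

@[simp] theorem nil_append {x y : V} (q : Chain H x y) : (nil y).append q = q := rfl

@[simp] theorem cons_append {x y z t : V} (f : H z t) (p : Chain H y z) (q : Chain H x y) :
    (cons f p).append q = cons f (p.append q) := rfl

@[simp] theorem append_nil {x y : V} (p : Chain H x y) : p.append (nil x) = p := by
  induction p with
  | nil => rfl
  | cons f p ih => simp [ih]

theorem append_assoc {x y z t : V} (p : Chain H z t) (q : Chain H y z) (r : Chain H x y) :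
    (p.append q).append r = p.append (q.append r) := by
  induction p with
  | nil => rfl
  | cons f p ih => simp [ih]

@[simp] theorem length_nil (x : V) : (nil x : Chain H x x).length = 0 := rfl

@[simp] theorem length_cons {x y z : V} (f : H y z) (p : Chain H x y) :
    (cons f p).length = p.length + 1 := rfl

@[simp] theorem length_append {x y z : V} (p : Chain H y z) (q : Chain H x y) :
    (p.append q).length = p.length + q.length := by
  induction p with
  | nil => simp
  | cons f p ih => simp [ih]; omega

theorem exists_cons_eq_snoc {x y : V} (p : Chain H x y) : ∀ {z : V} (f : H y z),
    ∃ (t : V) (q : Chain H t z) (g : H x t), cons f p = q.append (cons g (nil x)) := by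
  induction p with
  | nil => exact fun {z} f => ⟨_, nil z, f, rfl⟩
  | cons g p ih =>
    intro z f
    obtain ⟨t, q, g', h⟩ := ih g
    exact ⟨t, cons f q, g', by rw [h]; rfl⟩

/-- A composable sequence is empty or has a last entry on the right. -/
theorem snoc_cases {motive : ∀ {x y : V}, Chain H x y → Prop} (nil : ∀ x, motive (nil x))
    (snoc : ∀ {x y z : V} (p : Chain H y z) (f : H x y), motive (p.append (cons f (.nil x))))
    {x y : V} (p : Chain H x y) : motive p := by
  cases p with
  | nil => exact nil _
  | cons f p =>
    obtain ⟨t, q, g, h⟩ := exists_cons_eq_snoc p f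
    rw [h]
    exact snoc q g

/-- The ways of cutting a composable sequence with a marked entry: the cut is on the left or on the
right of that entry. -/
theorem splits_append_cons {x y z t : V} (p : Chain H z t) (m : H y z) (q : Chain H x y) :
    (p.append (cons m q)).splits =
      (p.splits.map fun s => ⟨s.1, s.2.1, s.2.2.append (cons m q)⟩) ++
        q.splits.map fun s => ⟨s.1, p.append (cons m s.2.1), s.2.2⟩ := by
  induction p with
  | nil => simp [splits]
  | cons f p ih => simp [splits, ih, Function.comp_def]

theorem append_of_mem_splits {x y : V} {p : Chain H x y} {s : Σ z : V, Chain H z y × Chain H x z}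
    (hs : s ∈ p.splits) : s.2.1.append s.2.2 = p := by
  induction p with
  | nil => simp only [splits, List.mem_singleton] at hs; subst hs; rfl
  | cons f p ih =>
    simp only [splits, List.mem_cons, List.mem_map] at hs
    rcases hs with rfl | ⟨s, hs, rfl⟩
    · rfl
    · simp [ih hs]

/-- If only the cut with empty left piece contributes to a sum over all cuts, it is the sum. -/
theorem sum_splits_of_left {A : Type*} [AddCommMonoid A] {x y : V} (p : Chain H x y)
    (G : (Σ z : V, Chain H z y × Chain H x z) → A)
    (h : ∀ s : Σ z : V, Chain H z y × Chain H x z, s.2.1.append s.2.2 = p → s.2.1.length ≠ 0 →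
      G s = 0) :
    (p.splits.map G).sum = G ⟨y, nil y, p⟩ := by
  cases p with
  | nil => simp [splits]
  | cons f p =>
    simp only [splits, List.map_cons, List.sum_cons, List.map_map]
    rw [List.sum_eq_zero, add_zero]
    simp only [List.mem_map, Function.comp]
    rintro _ ⟨s, hs, rfl⟩
    exact h _ (by simp [append_of_mem_splits hs]) (by simp)

/-- If only the cut with empty right piece contributes to a sum over all cuts, it is the sum. -/
theorem sum_splits_of_right {A : Type*} [AddCommMonoid A] {x y : V} (p : Chain H x y)
    (G : (Σ z : V, Chain H z y × Chain H x z) → A)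
    (h : ∀ s : Σ z : V, Chain H z y × Chain H x z, s.2.1.append s.2.2 = p → s.2.2.length ≠ 0 →
      G s = 0) :
    (p.splits.map G).sum = G ⟨x, p, nil x⟩ := by
  induction p using snoc_cases with
  | nil => simp [splits]
  | snoc p f =>
    rw [splits_append_cons, List.map_append, List.sum_append]
    simp only [splits, List.map_cons, List.map_nil, List.sum_singleton, List.map_map]
    rw [List.sum_eq_zero, zero_add]
    simp only [List.mem_map, Function.comp]
    rintro _ ⟨s, hs, rfl⟩
    exact h _ (by simp [← append_assoc, append_of_mem_splits hs]) (by simp)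

theorem sum_splits_eq_zero {A : Type*} [AddCommMonoid A] {x y : V} (p : Chain H x y)
    (G : (Σ z : V, Chain H z y × Chain H x z) → A)
    (h : ∀ s : Σ z : V, Chain H z y × Chain H x z, s.2.1.append s.2.2 = p → G s = 0) :
    (p.splits.map G).sum = 0 := by
  refine List.sum_eq_zero ?_
  simp only [List.mem_map]
  rintro _ ⟨s, hs, rfl⟩
  exact h s (append_of_mem_splits hs)

end Chain

/-! ### Signs and degrees -/

theorem sgn_add (k : Type w) [Ring k] (m n : ℤ) : sgn k (m + n) = sgn k m * sgn k n := by
  simp [sgn, Int.negOnePow_add]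

theorem sgn_of_even (k : Type w) [Ring k] {n : ℤ} (h : Even n) : sgn k n = 1 := by
  simp [sgn, Int.negOnePow_even n h]

theorem sgn_of_odd (k : Type w) [Ring k] {n : ℤ} (h : Odd n) : sgn k n = -1 := by
  simp [sgn, Int.negOnePow_odd n h]

theorem sgn_congr (k : Type w) [Ring k] {m n : ℤ} (h : Even (m - n)) : sgn k m = sgn k n := by
  rw [← sub_add_cancel m n, sgn_add, sgn_of_even k h, one_mul]

theorem sgn_mul_self (k : Type w) [Ring k] (n : ℤ) : sgn k n * sgn k n = 1 := by
  rw [← sgn_add]; exact sgn_of_even k (Even.add_self n)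

section Graded

variable {k : Type w} [Field k] {V : Type u}

@[simp] theorem GradedFamily.sdeg_nil (M : GradedFamily.{u, w, w'} k V) (x : V) :
    M.sdeg (.nil x) = 0 := rfl

@[simp] theorem GradedFamily.sdeg_cons (M : GradedFamily.{u, w, w'} k V) {x y z : V}
    (f : M.El y z) (p : Chain M.El x y) : M.sdeg (.cons f p) = (f.1 - 1) + M.sdeg p := rfl

@[simp] theorem GradedFamily.sdeg_append (M : GradedFamily.{u, w, w'} k V) {x y z : V}
    (p : Chain M.El y z) (q : Chain M.El x y) :
    M.sdeg (p.append q) = M.sdeg p + M.sdeg q := by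
  induction p with
  | nil => simp
  | cons f p ih => simp [ih, add_assoc]

/-! ### Bimodule relations -/

namespace AInfData

variable {C : AInfData.{u, w, w'} k V}

/-- The output of an operation may be recorded in any degree equal to the expected one. -/
theorem bEl_eq {x y : V} (p : Chain C.El x y) {d : ℤ} (h : d = C.sdeg p + 2) :
    C.bEl p = ⟨d, C.b p d⟩ := by subst h; rfl

/-- The `A_∞`-relation on a sequence with a marked entry is the bimodule relation of the diagonal
bimodule. -/
theorem relation_append_cons {x y z t : V} (p : Chain C.El z t) (m : C.El y z)
    (q : Chain C.El x y) (e : ℤ) :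
    C.relation (p.append (.cons m q)) e = C.diag.relation p m q e := by
  simp only [relation, BimodData.relation, Chain.splits_append_cons, List.map_append,
    List.sum_append, List.map_map, Function.comp_def, List.sum_map_add, Chain.append_assoc,
    Chain.cons_append]
  refine congrArg₂ _ (congrArg₂ _ ?_ ?_) ?_
  · refine congrArg List.sum (congrArg (List.map · _) (funext fun s => ?_))
    refine congrArg List.sum (congrArg (List.map · _) (funext fun t => ?_))
    rw [← Chain.cons_append, ← Chain.append_assoc]
    rfl
  · refine congrArg List.sum (congrArg (List.map · _) (funext fun s => ?_))
    refine congrArg List.sum (congrArg (List.map · _) (funext fun t => ?_))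
    -- the output of the inner operation, recorded in the degree used by `BimodData.actEl`
    rw [bEl_eq (d := C.sdeg s.2.2 + m.1 + C.sdeg t.2.1 + 1) _
      (by rw [GradedFamily.sdeg_append, GradedFamily.sdeg_cons]; ring)]
    rfl
  · refine congrArg List.sum (congrArg (List.map · _) (funext fun s => ?_))
    refine congrArg List.sum (congrArg (List.map · _) (funext fun t => ?_))
    rw [GradedFamily.sdeg_append, GradedFamily.sdeg_cons, add_assoc]
    rfl

theorem b_zero {x y z t : V} (p : Chain C.El z t) (d : ℤ) (q : Chain C.El x y) (e : ℤ) :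
    C.b (p.append (.cons ⟨d, (0 : C.obj y z d)⟩ q)) e = 0 := by
  have h := C.b_smul p d 0 0 q e
  rwa [zero_smul, zero_smul] at h

theorem diag_act_apply {x x' y y' : V} (p : Chain C.El x x') (q : Chain C.El y' y) (d e : ℤ)
    (m : C.obj y x d) : C.diag.act p q d e m = C.b (p.append (.cons ⟨d, m⟩ q)) e := rfl

theorem IsAInfCategory.diag_isBimodule (hC : C.IsAInfCategory) : C.diag.IsBimodule where
  left_add p a f g p' q d e := by
    refine LinearMap.ext fun m => ?_
    simp only [LinearMap.add_apply]
    erw [diag_act_apply, diag_act_apply, diag_act_apply]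
    simp only [Chain.append_assoc, Chain.cons_append]
    exact C.b_add p a f g _ e
  left_smul p a c f p' q d e := by
    refine LinearMap.ext fun m => ?_
    simp only [LinearMap.smul_apply]
    erw [diag_act_apply, diag_act_apply]
    simp only [Chain.append_assoc, Chain.cons_append]
    exact C.b_smul p a c f _ e
  right_add p q a f g q' d e := by
    refine LinearMap.ext fun m => ?_
    have h := C.b_add (p.append (.cons ⟨d, m⟩ q)) a f g q' e
    simp only [Chain.append_assoc, Chain.cons_append] at h
    exact h
  right_smul p q a c f q' d e := by
    refine LinearMap.ext fun m => ?_
    have h := C.b_smul (p.append (.cons ⟨d, m⟩ q)) a c f q' e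
    simp only [Chain.append_assoc, Chain.cons_append] at h
    exact h
  degree p q d e h := by
    refine LinearMap.ext fun m => hC.degree _ e ?_
    rw [GradedFamily.sdeg_append, GradedFamily.sdeg_cons]
    intro h'
    exact h (by rw [h']; ring)
  relation p m q e := (relation_append_cons p m q e).symm.trans (hC.relation _ e)
  one_left x y d m := hC.one_left d m
  one_right x y d m := hC.one_right d m
  one_vanish_left p p' q d e h := by
    refine LinearMap.ext fun m => ?_
    have h := hC.one_vanish p (p'.append (.cons ⟨d, m⟩ q)) e
      (by rw [Chain.length_append, Chain.length_cons]; omega)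
    rw [← Chain.cons_append, ← Chain.append_assoc] at h
    exact h
  one_vanish_right p q q' d e h := by
    refine LinearMap.ext fun m => ?_
    have h := hC.one_vanish (p.append (.cons ⟨d, m⟩ q)) q' e
      (by rw [Chain.length_append, Chain.length_cons]; omega)
    simp only [Chain.append_assoc, Chain.cons_append] at h
    exact h

end AInfData

section Transfer

variable {C : AInfData.{u, w, w'} k V} {M : BimodData.{u, w, w', w₁} C}
  {N : BimodData.{u, w, w', w₂} C} {f : GrMap M.toGradedFamily N.toGradedFamily}

/-- A strict morphism carries the bimodule expression of its source to that of its target. -/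
theorem IsStrictMor.map_relation (hf : IsStrictMor M N f) {x x' y y' : V} (p : Chain C.El x x')
    (m : M.El y x) (q : Chain C.El y' y) (e : ℤ) :
    f y' x' e (M.relation p m q e) = N.relation p ⟨m.1, f y x m.1 m.2⟩ q e := by
  simp only [BimodData.relation, map_add, map_list_sum, List.map_map, Function.comp_def, map_smul]
  refine congrArg₂ _ (congrArg₂ _ ?_ ?_) ?_
  all_goals
    refine congrArg List.sum (congrArg (List.map · _) (funext fun s => ?_))
    refine congrArg List.sum (congrArg (List.map · _) (funext fun t => ?_))
  · rw [hf]
  · rw [hf]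
    exact congrArg (fun v => _ • N.act _ _ _ _ v) (hf _ _ _ _ _)
  · rw [hf]

/-- The bimodule axioms are equations, so they pass to the source of an injective strict
morphism. -/
theorem BimodData.IsBimodule.of_injective (hN : N.IsBimodule) (hf : IsStrictMor M N f)
    (hi : ∀ x y d, Function.Injective (f x y d)) : M.IsBimodule where
  left_add p a g g' p' q d e := by
    ext m; apply hi; simp [hf _ _ _ _ _, hN.left_add]
  left_smul p a c g p' q d e := by
    ext m; apply hi; simp [hf _ _ _ _ _, hN.left_smul]
  right_add p q a g g' q' d e := by
    ext m; apply hi; simp [hf _ _ _ _ _, hN.right_add]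
  right_smul p q a c g q' d e := by
    ext m; apply hi; simp [hf _ _ _ _ _, hN.right_smul]
  degree p q d e h := by
    ext m; apply hi; simp [hf _ _ _ _ _, hN.degree _ _ _ _ h]
  relation p m q e := by
    apply hi; rw [hf.map_relation, hN.relation, map_zero]
  one_left x y d m := by
    apply hi; rw [hf, hN.one_left]
  one_right x y d m := by
    apply hi; rw [hf, hN.one_right, map_smul]
  one_vanish_left p p' q d e h := by
    ext m; apply hi; simp [hf _ _ _ _ _, hN.one_vanish_left _ _ _ _ _ h]
  one_vanish_right p q q' d e h := by
    ext m; apply hi; simp [hf _ _ _ _ _, hN.one_vanish_right _ _ _ _ _ h]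

/-- The bimodule axioms are equations, so they pass to the target of a surjective strict
morphism. -/
theorem BimodData.IsBimodule.of_surjective (hM : M.IsBimodule) (hf : IsStrictMor M N f)
    (hs : ∀ x y d, Function.Surjective (f x y d)) : N.IsBimodule where
  left_add p a g g' p' q d e := by
    ext m; obtain ⟨m, rfl⟩ := hs _ _ _ m; simp [← hf _ _ _ _ _, hM.left_add]
  left_smul p a c g p' q d e := by
    ext m; obtain ⟨m, rfl⟩ := hs _ _ _ m; simp [← hf _ _ _ _ _, hM.left_smul]
  right_add p q a g g' q' d e := by
    ext m; obtain ⟨m, rfl⟩ := hs _ _ _ m; simp [← hf _ _ _ _ _, hM.right_add]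
  right_smul p q a c g q' d e := by
    ext m; obtain ⟨m, rfl⟩ := hs _ _ _ m; simp [← hf _ _ _ _ _, hM.right_smul]
  degree p q d e h := by
    ext m; obtain ⟨m, rfl⟩ := hs _ _ _ m; simp [← hf _ _ _ _ _, hM.degree _ _ _ _ h]
  relation p m q e := by
    obtain ⟨d, m⟩ := m
    obtain ⟨m, rfl⟩ := hs _ _ _ m
    rw [← hf.map_relation p ⟨d, m⟩, hM.relation, map_zero]
  one_left x y d m := by
    obtain ⟨m, rfl⟩ := hs _ _ _ m; rw [← hf, hM.one_left]
  one_right x y d m := by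
    obtain ⟨m, rfl⟩ := hs _ _ _ m; rw [← hf, hM.one_right, map_smul]
  one_vanish_left p p' q d e h := by
    ext m; obtain ⟨m, rfl⟩ := hs _ _ _ m
    simp [← hf _ _ _ _ _, hM.one_vanish_left _ _ _ _ _ h]
  one_vanish_right p q q' d e h := by
    ext m; obtain ⟨m, rfl⟩ := hs _ _ _ m
    simp [← hf _ _ _ _ _, hM.one_vanish_right _ _ _ _ _ h]

theorem IsStrictMor.comp {N' : BimodData.{u, w, w', w₃} C}
    {g : GrMap N.toGradedFamily N'.toGradedFamily} (hg : IsStrictMor N N' g)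
    (hf : IsStrictMor M N f) : IsStrictMor M N' fun x y d => (g x y d).comp (f x y d) :=
  fun p q d e m => (congrArg _ (hf p q d e m)).trans (hg p q d e _)

theorem IsStrictMor.of_comp_injective {N' : BimodData.{u, w, w', w₃} C}
    {g : GrMap N.toGradedFamily N'.toGradedFamily} (hg : IsStrictMor N N' g)
    (hi : ∀ x y d, Function.Injective (g x y d))
    (hgf : IsStrictMor M N' fun x y d => (g x y d).comp (f x y d)) : IsStrictMor M N f :=
  fun p q d e m => hi _ _ _ ((hgf p q d e m).trans (hg p q d e _).symm)

theorem IsStrictMor.of_comp_surjective {N' : BimodData.{u, w, w', w₃} C}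
    {g : GrMap N.toGradedFamily N'.toGradedFamily} (hf : IsStrictMor M N f)
    (hs : ∀ x y d, Function.Surjective (f x y d))
    (hgf : IsStrictMor M N' fun x y d => (g x y d).comp (f x y d)) : IsStrictMor N N' g := by
  intro x x' y y' p q d e n
  obtain ⟨m, rfl⟩ := hs _ _ _ n
  exact (congrArg _ (hf p q d e m)).symm.trans (hgf p q d e m)

/-- The transpose of a strict morphism is a strict morphism of the dual bimodules. -/
theorem IsStrictMor.dual (hf : IsStrictMor M N f) : IsStrictMor N.dual M.dual (GrMap.dual f) := by
  intro x x' y y' p q d e φ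
  refine LinearMap.ext fun m => ?_
  exact congrArg (fun v => sgn k _ • DFunLike.coe (F := Module.Dual k (N.obj _ _ (3 - d))) φ v)
    (hf q p (3 - e) (3 - d) m).symm

end Transfer

/-! ### Sub-bimodules and quotient bimodules -/

section SubQuot

variable {C : AInfData.{u, w, w'} k V} (M : BimodData.{u, w, w', w₁} C)
  (S : ∀ x y d, Submodule k (M.obj x y d))

/-- A family of subspaces of a bimodule is closed if all operations map it to itself. -/
structure BimodData.IsClosed : Prop where
  act_mem : ∀ {x x' y y' : V} (p : Chain C.El x x') (q : Chain C.El y' y) (d e : ℤ)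
    (m : M.obj y x d), m ∈ S y x d → M.act p q d e m ∈ S y' x' e

variable {M S}

/-- The sub-bimodule on a closed family of subspaces. -/
def BimodData.sub (hS : M.IsClosed S) : BimodData.{u, w, w', w₁} C where
  obj x y d := S x y d
  act p q d e := (M.act p q d e).restrict (hS.act_mem p q d e)

/-- The inclusion of a sub-bimodule. -/
def BimodData.subι (hS : M.IsClosed S) :
    GrMap (BimodData.sub hS).toGradedFamily M.toGradedFamily :=
  fun x y d => (S x y d).subtype

/-- The quotient by the sub-bimodule on a closed family of subspaces. -/
def BimodData.quot (hS : M.IsClosed S) : BimodData.{u, w, w', w₁} C where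
  obj x y d := M.obj x y d ⧸ S x y d
  act p q d e := (S _ _ d).mapQ (S _ _ e) (M.act p q d e) (hS.act_mem p q d e)

/-- The projection to the quotient by a sub-bimodule. -/
def BimodData.quotπ (hS : M.IsClosed S) :
    GrMap M.toGradedFamily (BimodData.quot hS).toGradedFamily :=
  fun x y d => (S x y d).mkQ

theorem BimodData.subι_strict (hS : M.IsClosed S) :
    IsStrictMor (BimodData.sub hS) M (BimodData.subι hS) := fun _ _ _ _ _ => rfl

theorem BimodData.quotπ_strict (hS : M.IsClosed S) :
    IsStrictMor M (BimodData.quot hS) (BimodData.quotπ hS) := fun _ _ _ _ _ => rfl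

theorem BimodData.shortExact_subι_quotπ (hS : M.IsClosed S) :
    ShortExact (BimodData.subι hS) (BimodData.quotπ hS) := fun x y d =>
  ⟨(S x y d).subtype_injective, (S x y d).mkQ_surjective, by
    exact (Submodule.range_subtype _).trans (Submodule.ker_mkQ _).symm⟩

end SubQuot

/-! ### The relation in the presence of units -/

namespace AInfData

variable {C : AInfData.{u, w, w'} k V}

/-- By degree reasons, only one component of the `A_∞`-expression can be nonzero. -/
theorem relation_of_degree_ne
    (degree : ∀ {x y : V} (p : Chain C.El x y) (e : ℤ), e ≠ C.sdeg p + 2 → C.b p e = 0)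
    {x y : V} (p : Chain C.El x y) (e : ℤ) (he : e ≠ C.sdeg p + 3) : C.relation p e = 0 := by
  refine Chain.sum_splits_eq_zero _ _ fun s hs => Chain.sum_splits_eq_zero _ _ fun t ht => ?_
  rw [degree, smul_zero]
  rw [← hs, ← ht] at he
  simp only [GradedFamily.sdeg_append, GradedFamily.sdeg_cons, bEl] at he ⊢
  intro h
  exact he (by rw [h]; ring)

variable (one_left : ∀ {x y : V} (d : ℤ) (f : C.obj x y d),
    C.b (.cons ⟨0, C.one y⟩ (.cons ⟨d, f⟩ (.nil x))) d = f)
  (one_right : ∀ {x y : V} (d : ℤ) (f : C.obj x y d),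
    C.b (.cons ⟨d, f⟩ (.cons ⟨0, C.one x⟩ (.nil x))) d = sgn k d • f)
  (one_vanish : ∀ {x y z : V} (p : Chain C.El y z) (q : Chain C.El x y) (e : ℤ),
    p.length + q.length ≠ 1 → C.b (p.append (.cons ⟨0, C.one y⟩ q)) e = 0)

include one_right one_vanish in
/-- The terms whose inner operation lies left of the unit. -/
theorem sum_left_of_unit {x y z : V} (p : Chain C.El y z) (q : Chain C.El x y) (e : ℤ)
    (he : e = C.sdeg p + C.sdeg q + 2) :
    (p.splits.map fun s => (s.2.2.splits.map fun t => sgn k (C.sdeg s.2.1) •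
      C.b ((s.2.1.append (.cons (C.bEl t.2.1) t.2.2)).append (.cons ⟨0, C.one y⟩ q)) e).sum).sum =
    if q.length = 0 then sgn k (C.sdeg p) • C.b (p.append q) e else 0 := by
  cases q with
  | cons g q =>
    rw [if_neg (by simp)]
    refine Chain.sum_splits_eq_zero _ _ fun s hs => Chain.sum_splits_eq_zero _ _ fun t ht => ?_
    rw [one_vanish, smul_zero]
    simp only [Chain.length_append, Chain.length_cons]; omega
  | nil =>
    rw [Chain.sum_splits_of_left, Chain.sum_splits_of_right]
    · rw [bEl_eq (d := e) _ (by simpa using he)]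
      simp only [Chain.nil_append, Chain.cons_append, one_right, GradedFamily.sdeg_nil,
        Chain.length_nil, if_true, Chain.append_nil]
      rw [sgn_of_even k Even.zero, one_smul, he, sgn_congr k (n := C.sdeg p)]
      simp
    · intro t _ ht
      rw [one_vanish, smul_zero]
      simp only [Chain.length_append, Chain.length_cons, Chain.length_nil]; omega
    · intro s _ hs
      refine Chain.sum_splits_eq_zero _ _ fun t _ => ?_
      rw [one_vanish, smul_zero]
      simp only [Chain.length_append, Chain.length_cons, Chain.length_nil]; omega

include one_left one_vanish in
/-- The terms whose inner operation lies right of the unit. -/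
theorem sum_right_of_unit {x y z : V} (p : Chain C.El y z) (q : Chain C.El x y) (e : ℤ)
    (he : e = C.sdeg p + C.sdeg q + 2) :
    (q.splits.map fun s => (s.2.2.splits.map fun t => sgn k (C.sdeg p + (0 - 1) + C.sdeg s.2.1) •
      C.b (p.append (.cons ⟨0, C.one y⟩ (s.2.1.append (.cons (C.bEl t.2.1) t.2.2)))) e).sum).sum =
    if p.length = 0 then -(sgn k (C.sdeg p) • C.b (p.append q) e) else 0 := by
  cases p with
  | cons g p =>
    rw [if_neg (by simp)]
    refine Chain.sum_splits_eq_zero _ _ fun s hs => Chain.sum_splits_eq_zero _ _ fun t ht => ?_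
    rw [one_vanish, smul_zero]
    simp only [Chain.length_append, Chain.length_cons]; omega
  | nil =>
    rw [Chain.sum_splits_of_left, Chain.sum_splits_of_right]
    · rw [bEl_eq (d := e) _ (by simpa using he)]
      simp only [Chain.nil_append, one_left, GradedFamily.sdeg_nil, Chain.length_nil, if_true]
      rw [sgn_of_odd k (by decide), sgn_of_even k Even.zero, one_smul, neg_one_smul]
    · intro t _ ht
      rw [one_vanish, smul_zero]
      simp only [Chain.length_append, Chain.length_cons, Chain.length_nil]; omega
    · intro s _ hs
      refine Chain.sum_splits_eq_zero _ _ fun t _ => ?_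
      rw [one_vanish, smul_zero]
      simp only [Chain.length_append, Chain.length_cons, Chain.length_nil]; omega

include one_left one_right one_vanish in
/-- The terms whose inner operation has the unit among its inputs: only `b_2(f, 1)` and `b_2(1, g)`
contribute, where `f` and `g` are the neighbours of the unit. -/
theorem sum_around_unit {x y z : V} (p : Chain C.El y z) (q : Chain C.El x y) (e : ℤ) :
    (p.splits.map fun s => (q.splits.map fun t => sgn k (C.sdeg s.2.1) •
      C.b (s.2.1.append (.cons (C.bEl (s.2.2.append (.cons ⟨0, C.one y⟩ t.2.1))) t.2.2)) e).sum).sum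
    = (if q.length = 0 then 0 else sgn k (C.sdeg p) • C.b (p.append q) e) -
      (if p.length = 0 then 0 else sgn k (C.sdeg p) • C.b (p.append q) e) := by
  set F : (Σ t : V, Chain C.El t z × Chain C.El y t) → (Σ t : V, Chain C.El t y × Chain C.El x t) →
    C.obj x z e := fun s t => sgn k (C.sdeg s.2.1) •
      C.b (s.2.1.append (.cons (C.bEl (s.2.2.append (.cons ⟨0, C.one y⟩ t.2.1))) t.2.2)) e with hF
  have hF0 : ∀ s t, s.2.2.length + t.2.1.length ≠ 1 → F s t = 0 := by
    intro s t h
    simp only [hF]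
    rw [bEl, one_vanish _ _ _ h, b_zero, smul_zero]
  have hsplit : (p.splits.map fun s => (q.splits.map fun t => F s t).sum).sum =
      (p.splits.map fun s => if s.2.2.length = 0 then (q.splits.map fun t => F s t).sum else 0).sum
      + (p.splits.map fun s =>
        if s.2.2.length = 0 then 0 else (q.splits.map fun t => F s t).sum).sum := by
    rw [← List.sum_map_add]
    congr 2; funext s; split_ifs <;> simp
  rw [hsplit, sub_eq_add_neg]
  congr 1
  -- The inner operation has exactly two inputs: the unit and its right neighbour in the first case,
  -- the unit and its left neighbour in the second.
  · rw [Chain.sum_splits_of_right _ _ (fun s _ hs => if_neg hs), if_pos (Chain.length_nil _)]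
    cases q with
    | nil => simp [Chain.splits, hF0]
    | cons g q =>
      simp only [Chain.splits, List.map_cons, List.sum_cons, List.map_map, Function.comp_def]
      rw [hF0 _ _ (by simp), zero_add, Chain.sum_splits_of_left, if_neg (by simp)]
      · simp only [hF]
        rw [bEl_eq (d := g.1) _ (by simp; ring)]
        simp only [Chain.nil_append, one_left]
      · intro s _ hs
        exact hF0 _ _ (by simpa using hs)
  · have : ∀ s : (Σ t : V, Chain C.El t z × Chain C.El y t),
        (if s.2.2.length = 0 then 0 else (q.splits.map fun t => F s t).sum) =
        if s.2.2.length = 0 then 0 else F s ⟨y, .nil y, q⟩ := by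
      intro s
      split_ifs with h
      · rfl
      · exact Chain.sum_splits_of_left _ _ fun t _ ht => hF0 _ _ (by omega)
    simp only [this]
    clear hsplit this
    induction p using Chain.snoc_cases with
    | nil => simp [Chain.splits]
    | snoc p f =>
      rw [Chain.splits_append_cons]
      simp only [Chain.splits, List.map_append, List.map_map, Function.comp_def, List.map_cons,
        List.map_nil, List.sum_append, List.sum_singleton]
      rw [if_pos (by simp), add_zero, Chain.sum_splits_of_right, if_neg (by simp),
        if_neg (by simp)]
      · simp only [hF]
        rw [bEl_eq (d := f.1) _ (by simp; ring)]
        simp only [Chain.nil_append, Chain.cons_append, one_right, Chain.append_assoc]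
        rw [C.b_smul, smul_smul, ← sgn_add, ← neg_smul, GradedFamily.sdeg_append]
        congr 1
        -- `b_2(f, 1) = (-1)^{|f|} f`, whereas moving past `f` costs `(-1)^{|f| - 1}`
        rw [← neg_one_mul, ← sgn_of_odd k (n := -1) (by decide), ← sgn_add]
        exact sgn_congr k ⟨1, by simp; ring⟩
      · intro s _ hs
        rw [if_neg (by simp)]
        exact hF0 _ _ (by simpa using hs)

include one_left one_right one_vanish in
/-- The `A_∞`-relation on a sequence containing a unit follows from strict unitality. -/
theorem relation_unit
    (degree : ∀ {x y : V} (p : Chain C.El x y) (e : ℤ), e ≠ C.sdeg p + 2 → C.b p e = 0)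
    {x y z : V} (p : Chain C.El y z) (q : Chain C.El x y) (e : ℤ) :
    C.relation (p.append (.cons ⟨0, C.one y⟩ q)) e = 0 := by
  by_cases he : e = C.sdeg p + C.sdeg q + 2
  swap
  · refine relation_of_degree_ne degree _ _ ?_
    rw [GradedFamily.sdeg_append, GradedFamily.sdeg_cons]
    exact fun h => he (by rw [h]; ring)
  rw [relation_append_cons]
  have h1 := sum_left_of_unit one_right one_vanish p q e he
  have h2 := sum_around_unit one_left one_right one_vanish p q e
  have h3 := sum_right_of_unit one_left one_vanish p q e he
  have key : C.diag.relation p ⟨0, C.one y⟩ q e =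
      (if q.length = 0 then sgn k (C.sdeg p) • C.b (p.append q) e else 0) +
      ((if q.length = 0 then 0 else sgn k (C.sdeg p) • C.b (p.append q) e) -
      (if p.length = 0 then 0 else sgn k (C.sdeg p) • C.b (p.append q) e)) +
      (if p.length = 0 then -(sgn k (C.sdeg p) • C.b (p.append q) e) else 0) := by
    rw [← h1, ← h2, ← h3]
    refine congrArg₂ _ (congrArg₂ _ rfl ?_) rfl
    refine congrArg List.sum (congrArg (List.map · _) (funext fun s => ?_))
    refine congrArg List.sum (congrArg (List.map · _) (funext fun t => ?_))
    rw [bEl_eq (d := C.sdeg s.2.2 + 0 + C.sdeg t.2.1 + 1) _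
      (by rw [GradedFamily.sdeg_append, GradedFamily.sdeg_cons]; ring)]
    rfl
  refine key.trans ?_
  split_ifs <;> abel

end AInfData

namespace BimodData

variable {C : AInfData.{u, w, w'} k V}

/-- The bimodule expression is additive in the bimodule entry. -/
theorem relation_add {x x' y y' : V} (M : BimodData.{u, w, w', w₁} C) (p : Chain C.El x x')
    (d : ℤ) (m n : M.obj y x d) (q : Chain C.El y' y) (e : ℤ) :
    M.relation p ⟨d, m + n⟩ q e = M.relation p ⟨d, m⟩ q e + M.relation p ⟨d, n⟩ q e := by
  have h : ∀ {z z' : V} (p₁ : Chain C.El z x') (p₂ : Chain C.El x z) (q₁ : Chain C.El z' y)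
      (q₂ : Chain C.El y' z'), M.act p₁ q₂ _ e (M.actEl p₂ q₁ ⟨d, m + n⟩).2 =
      M.act p₁ q₂ _ e (M.actEl p₂ q₁ ⟨d, m⟩).2 + M.act p₁ q₂ _ e (M.actEl p₂ q₁ ⟨d, n⟩).2 :=
    fun p₁ p₂ q₁ q₂ => (congrArg (M.act p₁ q₂ _ e) (map_add _ _ _)).trans (map_add _ _ _)
  simp only [relation, h]
  simp only [map_add, smul_add, List.sum_map_add]
  abel

/-- The bimodule expression is homogeneous in the bimodule entry. -/
theorem relation_smul {x x' y y' : V} (M : BimodData.{u, w, w', w₁} C) (p : Chain C.El x x')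
    (d : ℤ) (c : k) (m : M.obj y x d) (q : Chain C.El y' y) (e : ℤ) :
    M.relation p ⟨d, c • m⟩ q e = c • M.relation p ⟨d, m⟩ q e := by
  have h : ∀ {z z' : V} (p₁ : Chain C.El z x') (p₂ : Chain C.El x z) (q₁ : Chain C.El z' y)
      (q₂ : Chain C.El y' z'), M.act p₁ q₂ _ e (M.actEl p₂ q₁ ⟨d, c • m⟩).2 =
      c • M.act p₁ q₂ _ e (M.actEl p₂ q₁ ⟨d, m⟩).2 :=
    fun p₁ p₂ q₁ q₂ => (congrArg (M.act p₁ q₂ _ e) (map_smul _ _ _)).trans (map_smul _ _ _)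
  simp only [relation, h]
  simp only [map_smul, smul_comm _ c, smul_add, List.smul_sum, List.map_map, Function.comp_def]

end BimodData

/-! ### Calabi–Yau structures and Lagrangian sub-bimodules -/

namespace Pairing

variable {C : AInfData.{u, w, w'} k V} {P : Pairing C}

theorem cyc_eq {x y : V} (p : Chain C.El x y) (f : C.El y x) {d : ℤ} (h : d = C.sdeg p + 2) :
    P.cyc p f = sgn k d * P x y d f.1 (C.b p d) f.2 := by
  subst h; rfl

namespace IsCalabiYau

/-- In complementary degrees `d` and `3 - d`, one of which is even, the pairing is symmetric. -/
theorem symm' (hP : P.IsCalabiYau) (x y : V) (d : ℤ) (f : C.obj x y d) (g : C.obj y x (3 - d)) :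
    P x y d (3 - d) f g = P y x (3 - d) d g f := by
  rw [hP.symm, sgn_of_even, one_mul]
  rcases Int.even_or_odd d with h | h
  · exact h.mul_right _
  · exact (Odd.sub_odd (by decide) h).mul_left _

/-- Cyclic invariance, applied repeatedly: rotating several entries costs the Koszul sign. -/
theorem cyc_rotate (hP : P.IsCalabiYau) {x y z t : V} (p : Chain C.El z t) (m : C.El y z)
    (q : Chain C.El x y) (n : C.El t x) :
    P.cyc (p.append (.cons m q)) n =
      sgn k ((C.sdeg p + (m.1 - 1)) * (C.sdeg q + (n.1 - 1))) *
        P.cyc (q.append (.cons n p)) m := by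
  induction p generalizing x with
  | nil => simpa using hP.cyclic m q n
  | cons f p ih =>
    rw [Chain.cons_append, hP.cyclic, Chain.append_assoc, Chain.cons_append, ih,
      Chain.append_assoc, Chain.cons_append, Chain.nil_append, ← mul_assoc, ← sgn_add]
    congr 1
    refine sgn_congr k ⟨(f.1 - 1) * (C.sdeg p + (m.1 - 1)), ?_⟩
    simp only [GradedFamily.sdeg_append, GradedFamily.sdeg_cons, GradedFamily.sdeg_nil]
    ring

/-- Cyclic invariance, rotated so that the output of one operation becomes an input of the other. -/
theorem pairing_b (hC : C.IsAInfCategory) (hP : P.IsCalabiYau) {x x' y y' : V}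
    (p : Chain C.El x x') (q : Chain C.El y' y) (d e : ℤ) (m : C.obj y x d)
    (m' : C.obj x' y' (3 - e)) :
    P y' x' e (3 - e) (C.b (p.append (.cons ⟨d, m⟩ q)) e) m' =
      sgn k (C.sdeg p + ((3 - e) - 1)) *
        P y x d (3 - d) m (C.b (q.append (.cons ⟨3 - e, m'⟩ p)) (3 - d)) := by
  by_cases he : e = C.sdeg p + d + C.sdeg q + 1
  · have h := hP.cyc_rotate p ⟨d, m⟩ q ⟨3 - e, m'⟩
    rw [cyc_eq (d := e) _ _ (by simp; rw [he]; ring),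
      cyc_eq (d := 3 - d) _ _ (by simp; rw [he]; ring)] at h
    have h' := congrArg (sgn k e * ·) h
    simp only [← mul_assoc, sgn_mul_self, one_mul] at h'
    rw [h', hP.symm' y x d, ← sgn_add, ← sgn_add]
    congr 1
    -- With `s = ‖p‖ + d - 1`, the two signs differ by `(-1)^{s (s + 1)} = 1`.
    obtain ⟨a, ha⟩ := Int.even_mul_succ_self (C.sdeg p + d - 1)
    refine sgn_congr k ⟨e - a, ?_⟩
    have hq : C.sdeg q = e - C.sdeg p - d - 1 := by rw [he]; ring
    rw [hq]
    linear_combination -ha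
  · have he' : e ≠ C.sdeg (p.append (.cons ⟨d, m⟩ q)) + 2 := by
      simp only [GradedFamily.sdeg_append, GradedFamily.sdeg_cons]
      exact fun h => he (by linarith)
    have he'' : 3 - d ≠ C.sdeg (q.append (.cons ⟨3 - e, m'⟩ p)) + 2 := by
      simp only [GradedFamily.sdeg_append, GradedFamily.sdeg_cons]
      exact fun h => he (by linarith)
    rw [hC.degree _ _ he', hC.degree _ _ he'', map_zero, map_zero, LinearMap.zero_apply, mul_zero]

/-- The map `τ` is a strict morphism of bimodules. -/
theorem tau_strict (hC : C.IsAInfCategory) (hP : P.IsCalabiYau) :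
    IsStrictMor C.diag C.diag.dual P.tau :=
  fun p q d e m => LinearMap.ext fun m' => hP.pairing_b hC p q d e m m'

theorem tau_injective (hP : P.IsCalabiYau) (x y : V) (d : ℤ) :
    Function.Injective (P.tau x y d) := by
  rw [injective_iff_map_eq_zero]
  intro f hf
  exact hP.nondegenerate x y d f fun g => congrArg
    (fun v => DFunLike.coe (F := Module.Dual k (C.obj y x (3 - d))) v g) hf

/-- A nondegenerate pairing of finite-dimensional spaces is perfect. -/
theorem tau_bijective (hP : P.IsCalabiYau) (hfd : ∀ x y d, FiniteDimensional k (C.obj x y d))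
    (x y : V) (d : ℤ) : Function.Bijective (P.tau x y d) := by
  have := hfd x y d
  have := hfd y x (3 - d)
  have hr : Function.Injective (P x y d (3 - d)).flip := by
    rw [injective_iff_map_eq_zero]
    intro g hg
    refine hP.nondegenerate y x (3 - d) g ?_
    have : ∀ d', d' = d → ∀ f, P y x (3 - d) d' g f = 0 := by
      rintro _ rfl f
      rw [← hP.symm']
      exact LinearMap.congr_fun hg f
    exact this _ (by ring)
  have hl : Function.Injective (P x y d (3 - d)) := hP.tau_injective x y d
  have h1 := LinearMap.finrank_le_finrank_of_injective hl
  have h2 := LinearMap.finrank_le_finrank_of_injective hr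
  rw [Subspace.dual_finrank_eq] at h1 h2
  refine ⟨hl, ?_⟩
  exact (LinearMap.injective_iff_surjective_of_finrank_eq_finrank (f := P x y d (3 - d))
    (by rw [Subspace.dual_finrank_eq]; omega)).1 hl

end IsCalabiYau

end Pairing

section Lagrangian

/-- The transpose of a short exact sequence is exact. -/
theorem ShortExact.dual {L : GradedFamily.{u, w, w₁} k V} {M : GradedFamily.{u, w, w₂} k V}
    {N : GradedFamily.{u, w, w₃} k V} {i : GrMap L M} {q : GrMap M N} (h : ShortExact i q) :
    ShortExact (GrMap.dual q) (GrMap.dual i) := fun x y d => by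
  obtain ⟨hi, hq, hr⟩ := h y x (3 - d)
  refine ⟨LinearMap.dualMap_injective_of_surjective hq,
    LinearMap.dualMap_surjective_of_injective hi, ?_⟩
  change LinearMap.range (q y x (3 - d)).dualMap = LinearMap.ker (i y x (3 - d)).dualMap
  rw [LinearMap.range_dualMap_eq_dualAnnihilator_ker, LinearMap.ker_dualMap_eq_dualAnnihilator_range,
    hr]

theorem GrMap.map_degCast {M : GradedFamily.{u, w, w₁} k V} {N : GradedFamily.{u, w, w₂} k V}
    (f : GrMap M N) {x y : V} {d e : ℤ} (h : d = e) (m : M.obj x y d) :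
    f x y e (M.degCast h m) = N.degCast h (f x y d m) := by
  subst h; rfl

variable {C : AInfData.{u, w, w'} k V} {P : Pairing C}

theorem Pairing.apply_degCast {x y : V} {c d e : ℤ} (h : d = e) (f : C.obj x y c)
    (m : C.obj y x d) : P x y c e f (C.degCast h m) = P x y c d f m := by
  subst h; rfl

/-- A closed family of subspaces which is its own orthogonal complement for the Calabi–Yau pairing
is a Lagrangian sub-bimodule: the pairing descends to a perfect pairing between the sub-bimodule and
the quotient bimodule. -/
theorem isLagrangian_subι (hC : C.IsAInfCategory) (hP : P.IsCalabiYau)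
    (hfd : ∀ x y d, FiniteDimensional k (C.obj x y d))
    (S : ∀ x y d, Submodule k (C.diag.obj x y d)) (hS : C.diag.IsClosed S)
    (horth : ∀ x y d (m : C.obj x y d),
      m ∈ S x y d ↔ ∀ s ∈ S y x (3 - d), P x y d (3 - d) m s = 0) :
    IsLagrangian P (BimodData.sub hS) (BimodData.subι hS) := by
  have hi : IsStrictMor (BimodData.sub hS) C.diag (BimodData.subι hS) := BimodData.subι_strict hS
  have hq : IsStrictMor C.diag (BimodData.quot hS) (BimodData.quotπ hS) :=
    BimodData.quotπ_strict hS
  have hi' : IsStrictMor C.diag.dual (BimodData.sub hS).dual (GrMap.dual (BimodData.subι hS)) :=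
    IsStrictMor.dual hi
  have hq' : IsStrictMor (BimodData.quot hS).dual C.diag.dual (GrMap.dual (BimodData.quotπ hS)) :=
    IsStrictMor.dual hq
  have hex := BimodData.shortExact_subι_quotπ hS
  have hτ : IsStrictMor C.diag C.diag.dual P.tau := hP.tau_strict hC
  have hτb := hP.tau_bijective hfd
  have hann : ∀ x y d, S y x (3 - d) ≤
      LinearMap.ker ((P.tau x y d).comp (S x y d).subtype).flip := by
    intro x y d m hm
    refine LinearMap.ext fun s => ?_
    exact (horth x y d s.1).1 s.2 m hm
  -- The pairing, restricted to the sub-bimodule and descended to the quotient.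
  let τL : GrMap (BimodData.sub hS).toGradedFamily (BimodData.quot hS).dual.toGradedFamily :=
    fun x y d => ((S y x (3 - d)).liftQ _ (hann x y d)).flip
  let τN : GrMap (BimodData.quot hS).toGradedFamily (BimodData.sub hS).dual.toGradedFamily :=
    fun x y d => (GrMap.dual τL x y d).comp ((BimodData.quot hS).toDoubleDual x y d)
  have sq1 : ∀ x y d, (GrMap.dual (BimodData.quotπ hS) x y d).comp (τL x y d) =
      (P.tau x y d).comp (BimodData.subι hS x y d) := fun x y d => rfl
  have sq2 : ∀ x y d, (τN x y d).comp (BimodData.quotπ hS x y d) =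
      (GrMap.dual (BimodData.subι hS) x y d).comp (P.tau x y d) := by
    intro x y d
    refine LinearMap.ext fun m => LinearMap.ext fun l => ?_
    have h : d = 3 - (3 - d) := by ring
    change DFunLike.coe (F := Module.Dual k ((BimodData.quot hS).obj x y (3 - (3 - d))))
      (τL y x (3 - d) l) ((BimodData.quot hS).degCast h (BimodData.quotπ hS x y d m)) = _
    rw [← GrMap.map_degCast]
    exact (Pairing.apply_degCast (P := P) h l.1 m).trans (hP.symm' x y d m l.1).symm
  refine ⟨hC.diag_isBimodule.of_injective hi fun x y d => (hex x y d).1,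
    BimodData.quot hS, BimodData.quotπ hS, τL, τN,
    hC.diag_isBimodule.of_surjective hq fun x y d => (hex x y d).2.1,
    hi, hq, hex, hq', hi', hex.dual, ⟨?_, ?_⟩, ⟨hτ, hτb⟩, ⟨?_, ?_⟩,
    fun _ _ _ => rfl, sq1, sq2⟩
  -- Strictness of `τL` and `τN` is inherited from `τ` through the two squares.
  · refine IsStrictMor.of_comp_injective (M := BimodData.sub hS) (N := (BimodData.quot hS).dual)
      (N' := C.diag.dual) (f := τL) (g := GrMap.dual (BimodData.quotπ hS)) hq'
      (fun x y d => (hex.dual x y d).1) ?_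
    exact IsStrictMor.comp (M := BimodData.sub hS) (N := C.diag) (N' := C.diag.dual)
      (f := BimodData.subι hS) (g := P.tau) hτ hi
  · intro x y d
    have hinj : Function.Injective ((P.tau x y d).comp (BimodData.subι hS x y d)) :=
      (hτb x y d).1.comp (hex x y d).1
    rw [← sq1] at hinj
    refine ⟨Function.Injective.of_comp (f := GrMap.dual (BimodData.quotπ hS) x y d) hinj,
      fun φ => ?_⟩
    obtain ⟨f, hf⟩ := (hτb x y d).2 (GrMap.dual (BimodData.quotπ hS) x y d φ)
    have hfS : f ∈ S x y d := by
      refine (horth x y d f).2 fun s hs => ?_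
      refine (congrArg (fun v => DFunLike.coe (F := Module.Dual k (C.obj y x (3 - d))) v s)
        hf).trans ?_
      have h0 : BimodData.quotπ hS y x (3 - d) s = 0 := (Submodule.Quotient.mk_eq_zero _).2 hs
      refine (congrArg
        (DFunLike.coe (F := Module.Dual k ((BimodData.quot hS).obj y x (3 - d))) φ) h0).trans ?_
      exact LinearMap.map_zero (M₃ := k) φ
    exact ⟨⟨f, hfS⟩, (hex.dual x y d).1
      ((LinearMap.congr_fun (sq1 x y d) ⟨f, hfS⟩).trans hf)⟩
  · refine IsStrictMor.of_comp_surjective (M := C.diag) (N := BimodData.quot hS)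
      (N' := (BimodData.sub hS).dual) (f := BimodData.quotπ hS) (g := τN) hq (fun x y d => (hex x y d).2.1) ?_
    simp only [sq2]
    exact IsStrictMor.comp (M := C.diag) (N := C.diag.dual) (N' := (BimodData.sub hS).dual)
      (f := P.tau) (g := GrMap.dual (BimodData.subι hS)) hi' hτ
  · intro x y d
    constructor
    · rw [injective_iff_map_eq_zero]
      intro n hn
      obtain ⟨m, rfl⟩ := (hex _ _ _).2.1 n
      refine (Submodule.Quotient.mk_eq_zero _).2 ((horth x y d m).2 fun s hs => ?_)
      exact congrArg (fun v => DFunLike.coe (F := Module.Dual k (S y x (3 - d))) v ⟨s, hs⟩)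
        ((LinearMap.congr_fun (sq2 x y d) m).symm.trans hn)
    · have hsurj : Function.Surjective
          ((GrMap.dual (BimodData.subι hS) x y d).comp (P.tau x y d)) :=
        (hex.dual x y d).2.1.comp (hτb x y d).2
      rw [← sq2] at hsurj
      exact Function.Surjective.of_comp (g := BimodData.quotπ hS x y d) hsurj

end Lagrangian

end Graded

section QP

open scoped Classical

variable {k : Type w} [Field k] {V : Type u} [Quiver.{v} V]

/-! ### The structure coefficients on basis elements -/

/-- The multiplicity with which a list occurs among its own rotations is rotation invariant. -/
theorem count_cyclicPermutations_rotate {α : Type*} (l : List α) (n : ℕ) :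
    (l.rotate n).cyclicPermutations.count (l.rotate n) = l.cyclicPermutations.count l := by
  have h : l.cyclicPermutations.map (fun l' => l'.rotate n) = l.cyclicPermutations.rotate n := by
    refine List.ext_getElem (by simp) fun i h₁ h₂ => ?_
    rcases eq_or_ne l [] with rfl | hl
    · simp
    have hlen := List.length_cyclicPermutations_of_ne_nil l hl
    simp only [List.getElem_map, List.getElem_cyclicPermutations, List.getElem_rotate,
      List.rotate_rotate, hlen]
    rw [List.rotate_mod]
  rw [List.cyclicPermutations_rotate, ← h]
  exact List.count_map_of_injective _ _ (List.rotate_injective n) _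

/-- The coefficients of `μ(W)` are cyclically invariant. -/
theorem Potential.mu_rotate (W : Potential k V) (l : List (Quiver.Total V)) (n : ℕ) :
    W.mu (l.rotate n) = W.mu l := by
  have h : ((l.rotate n : List (Quiver.Total V)) : Cycle (Quiver.Total V)) = l :=
    Cycle.coe_eq_coe.2 (List.IsRotated.symm ⟨n, rfl⟩)
  rw [Potential.mu, Potential.mu, h, count_cyclicPermutations_rotate, List.length_rotate]

namespace Gen

/-- A sequence consists of dual arrows if and only if both of its pieces do. -/
theorem word_append {x y z : V} (p : Chain (Gen V) y z) (q : Chain (Gen V) x y) :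
    word (p.append q) = (word p).bind fun l => (word q).map (l ++ ·) := by
  induction p with
  | nil => simp [word]
  | cons f p ih =>
    cases f <;> simp [word, ih]
    cases word p <;> simp [Function.comp_def]

/-- The shifted degree of a composable sequence of basis elements. -/
def sdeg {x : V} : {y : V} → Chain (Gen V) x y → ℤ
  | _, .nil _ => 0
  | _, .cons f p => (f.deg - 1) + sdeg p

@[simp] theorem sdeg_append {x y z : V} (p : Chain (Gen V) y z) (q : Chain (Gen V) x y) :
    sdeg (p.append q) = sdeg p + sdeg q := by
  induction p with
  | nil => simp [sdeg]
  | cons f p ih => simp [sdeg, ih, add_assoc]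

/-- Dual arrows have shifted degree zero. -/
theorem sdeg_eq_zero_of_word {x y : V} (p : Chain (Gen V) x y) (h : word p ≠ none) :
    sdeg p = 0 := by
  induction p with
  | nil => rfl
  | cons f p ih => cases f <;> simp_all [word, sdeg, deg]

theorem swap_swap {x y : V} (g : Gen V x y) : g.swap.swap = g := by cases g <;> rfl

theorem deg_swap {x y : V} (g : Gen V x y) : g.swap.deg = 3 - g.deg := by cases g <;> rfl

theorem eq_swap_iff {x y : V} (g : Gen V x y) (h : Gen V y x) : h = g.swap ↔ g = h.swap := by
  constructor <;> rintro rfl <;> rw [swap_swap]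

theorem deg_mem {x y : V} (g : Gen V x y) : g.deg ∈ Set.Icc (0 : ℤ) 3 := by
  cases g <;> simp [deg]

theorem comp_one_right {x y : V} (f h : Gen V x y) :
    comp f (.one x) h = if h = f then sgn k f.deg else 0 := by
  cases f <;> simp [comp, deg, sgn_of_even k (n := 0) (by decide)]

theorem comp_of_degree_ne {x y z : V} (f : Gen V y z) (g : Gen V x y) (h : Gen V x z)
    (hd : h.deg ≠ f.deg + g.deg) : comp (k := k) f g h = 0 := by
  cases f <;> cases g <;> cases h <;> simp_all [comp, deg]

/-- The part of `b_2` independent of the potential is cyclically invariant. -/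
theorem comp_cyclic {x y z : V} (f : Gen V y z) (g : Gen V x y) (h : Gen V z x) :
    sgn k (f.deg + g.deg) * comp (k := k) f g h.swap =
      sgn k ((f.deg - 1) * ((g.deg - 1) + (h.deg - 1))) * sgn k (g.deg + h.deg) *
        comp (k := k) g h f.swap := by
  have h₀ : sgn k 0 = 1 := sgn_of_even k (by decide)
  have h₁ : sgn k 1 = -1 := sgn_of_odd k (by decide)
  have h₂ : sgn k 2 = 1 := sgn_of_even k (by decide)
  have h₃ : sgn k 3 = -1 := sgn_of_odd k (by decide)
  have h₄ : sgn k (-1) = -1 := sgn_of_odd k (by decide)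
  have h₅ : sgn k (-4) = 1 := sgn_of_even k (by decide)
  cases f <;> cases g <;> cases h <;> simp [comp, deg, swap, h₀, h₁, h₂, h₃, h₄, h₅] <;>
    simp only [eq_comm]

end Gen

namespace Potential

variable (W : Potential k V)

/-- The coefficient in `μ(W)` of the path traversing `a_n, …, a_1`, for a sequence
`(a_n^*, …, a_1^*)`; zero for all other sequences of basis elements. -/
noncomputable def pathCoeff {x y : V} (p : Chain (Gen V) x y) : k :=
  (Gen.word p).elim 0 W.mu

/-- The coefficient of `a` in the contraction with `p` is the coefficient of the closed path obtained
by appending `a^*` to `p`. -/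
theorem contract_swap {x y : V} (p : Chain (Gen V) x y) (g : Gen V y x) :
    W.contract p g.swap = W.pathCoeff (p.append (.cons g (.nil y))) := by
  cases g <;> simp [Gen.swap, contract, pathCoeff, Gen.word_append, Gen.word]
  cases Gen.word p <;> simp

theorem pathCoeff_rotate {x y : V} (p : Chain (Gen V) x y) (g : Gen V y x) :
    W.pathCoeff (.cons g p) = W.pathCoeff (p.append (.cons g (.nil y))) := by
  cases g <;> simp [pathCoeff, Gen.word_append, Gen.word]
  cases Gen.word p with
  | none => rfl
  | some l => exact (W.mu_rotate (_ :: l) 1).symm.trans (by simp)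

theorem contract_cyclic {x y z : V} (f : Gen V y z) (p : Chain (Gen V) x y) (g : Gen V z x) :
    W.contract (.cons f p) g.swap = W.contract (p.append (.cons g (.nil z))) f.swap := by
  rw [contract_swap, contract_swap, Chain.cons_append, pathCoeff_rotate]

theorem contract_nil {x : V} (h : Gen V x x) : W.contract (.nil x) h = 0 := by
  rw [← h.swap_swap, contract_swap]
  cases h <;> simp [pathCoeff, Gen.swap, Gen.word]
  rw [mu]
  -- the only candidate is a cycle of length one
  by_contra h
  have := W.two_le_length _ (left_ne_zero_of_mul h)
  simp at this

theorem contract_of_word_eq_none {x y : V} (p : Chain (Gen V) x y) (hp : Gen.word p = none)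
    (h : Gen V x y) : W.contract p h = 0 := by
  cases h <;> simp [contract, hp]

theorem contract_of_degree_ne {x y : V} (p : Chain (Gen V) x y) (h : Gen V x y)
    (hd : h.deg ≠ Gen.sdeg p + 2) : W.contract p h = 0 := by
  by_cases hp : Gen.word p = none
  · exact W.contract_of_word_eq_none p hp h
  · rw [Gen.sdeg_eq_zero_of_word p hp] at hd
    cases h <;> simp_all [contract, Gen.deg]

theorem structureCoeff_of_length_ne {x y : V} (p : Chain (Gen V) x y) (hp : p.length ≠ 2)
    (h : Gen V x y) : W.structureCoeff p h = W.contract p h := by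
  rcases p with _ | ⟨f, _ | ⟨g, _ | _⟩⟩ <;> first | rfl | simp at hp

theorem structureCoeff_pair {x y z : V} (f : Gen V y z) (g : Gen V x y) (h : Gen V x z) :
    W.structureCoeff (.cons f (.cons g (.nil x))) h =
      Gen.comp f g h + W.contract (.cons f (.cons g (.nil x))) h := rfl

theorem structureCoeff_of_degree_ne {x y : V} (p : Chain (Gen V) x y) (h : Gen V x y)
    (hd : h.deg ≠ Gen.sdeg p + 2) : W.structureCoeff p h = 0 := by
  by_cases hp : p.length = 2
  · rcases p with _ | ⟨f, _ | ⟨g, _ | _⟩⟩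
    · simp at hp
    · simp at hp
    · rw [structureCoeff_pair, contract_of_degree_ne _ _ _ hd, Gen.comp_of_degree_ne, add_zero]
      intro h'
      simp only [Gen.sdeg] at hd
      exact hd (by rw [h']; ring)
    · simp at hp
  · rw [structureCoeff_of_length_ne _ _ hp, contract_of_degree_ne _ _ _ hd]

/-- Cyclic invariance on basis elements. -/
theorem structureCoeff_cyclic {x y z : V} (f : Gen V y z) (p : Chain (Gen V) x y) (g : Gen V z x) :
    sgn k ((f.deg - 1) + Gen.sdeg p + 2) * W.structureCoeff (.cons f p) g.swap =
      sgn k ((f.deg - 1) * (Gen.sdeg p + (g.deg - 1))) *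
        (sgn k (Gen.sdeg p + (g.deg - 1) + 2) *
          W.structureCoeff (p.append (.cons g (.nil z))) f.swap) := by
  have hc : sgn k ((f.deg - 1) + Gen.sdeg p + 2) * W.contract (.cons f p) g.swap =
      sgn k ((f.deg - 1) * (Gen.sdeg p + (g.deg - 1))) *
        (sgn k (Gen.sdeg p + (g.deg - 1) + 2) *
          W.contract (p.append (.cons g (.nil z))) f.swap) := by
    rw [← contract_cyclic]
    by_cases hw : Gen.word (p.append (.cons g (.nil z))) = none
    · rw [contract_cyclic, contract_of_word_eq_none _ _ hw, mul_zero, mul_zero, mul_zero]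
    by_cases hw' : Gen.word (.cons f p) = none
    · rw [contract_of_word_eq_none _ _ hw', mul_zero, mul_zero, mul_zero]
    have h₁ := Gen.sdeg_eq_zero_of_word _ hw
    have h₂ := Gen.sdeg_eq_zero_of_word _ hw'
    simp only [Gen.sdeg_append, Gen.sdeg, add_zero] at h₁ h₂
    rw [h₁, h₂, mul_zero, zero_add, sgn_of_even k (n := 0) (by decide),
      sgn_of_even k (n := 2) (by decide), one_mul, one_mul]
  by_cases hp : p.length = 1
  · rcases p with _ | ⟨a, _ | _⟩
    · simp at hp
    · simp only [Chain.cons_append, Chain.nil_append, structureCoeff_pair, mul_add] at hc ⊢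
      rw [hc]
      congr 1
      have := Gen.comp_cyclic (k := k) f a g
      rw [mul_assoc] at this
      convert this using 2
      · simp only [Gen.sdeg]; congr 1; ring
      · simp only [Gen.sdeg, add_zero]; congr 1; ring
      · simp only [Gen.sdeg]; congr 2; ring
    · simp at hp
  · rw [structureCoeff_of_length_ne, structureCoeff_of_length_ne, hc]
    · simpa using hp
    · simpa using hp

end Potential

/-! ### Sequences without identities -/

namespace Gen

/-- A sequence of basis elements none of which is an identity. -/
def NoOne {x y : V} (r : Chain (Gen V) x y) : Prop :=
  ∀ (z : V) (p : Chain (Gen V) z y) (q : Chain (Gen V) x z), r ≠ p.append (.cons (.one z) q)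

theorem NoOne.left {x y z : V} {p : Chain (Gen V) y z} {q : Chain (Gen V) x y}
    (h : NoOne (p.append q)) : NoOne p := by
  rintro t p₁ p₂ rfl
  exact h t p₁ (p₂.append q) (by rw [Chain.append_assoc, Chain.cons_append])

theorem NoOne.right {x y z : V} {p : Chain (Gen V) y z} {q : Chain (Gen V) x y}
    (h : NoOne (p.append q)) : NoOne q := by
  rintro t q₁ q₂ rfl
  exact h t (p.append q₁) q₂ (by rw [Chain.append_assoc])

theorem NoOne.deg_pos {x y z : V} {f : Gen V y z} {p : Chain (Gen V) x y}
    (h : NoOne (.cons f p)) : 0 < f.deg := by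
  cases f with
  | one => exact absurd rfl (h _ (.nil _) p)
  | _ => simp [deg]

theorem comp_eq_zero {x y z : V} {f : Gen V y z} {g : Gen V x y} {h : Gen V x z}
    (hf : 0 < f.deg) (hg : 0 < g.deg) (hh : h.deg < 3) : comp (k := k) f g h = 0 := by
  cases f <;> cases g <;> cases h <;> simp_all [comp, deg]

theorem comp_omega_left {x y : V} {u : Gen V y x} {g : Gen V x y} (hu : 2 ≤ u.deg)
    (hg : 0 < g.deg) : comp u g (.omega x) = if u = g.swap then (1 : k) else 0 := by
  cases u <;> cases g <;> simp_all [comp, deg, swap]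
  simp only [eq_comm]

theorem comp_omega_right {x y : V} {f : Gen V y x} {u : Gen V x y} (hf : 0 < f.deg)
    (hu : 2 ≤ u.deg) : comp f u (.omega x) = if u = f.swap then (-1 : k) else 0 := by
  cases f <;> cases u <;> simp_all [comp, deg, swap]

theorem word_eq_none {x y z t : V} (p : Chain (Gen V) z t) {u : Gen V y z} (hu : u.deg ≠ 1)
    (q : Chain (Gen V) x y) : word (p.append (.cons u q)) = none := by
  rw [word_append]
  cases u <;> simp_all [word, deg]

end Gen

namespace Potential

variable (W : Potential k V)

theorem contract_of_deg_ne_two {x y : V} (p : Chain (Gen V) x y) {u : Gen V x y}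
    (hu : u.deg ≠ 2) : W.contract p u = 0 := by
  cases u <;> simp_all [contract, Gen.deg]

/-- Without identities among the inputs, the coefficients of all basis elements other than the `ω_x`
come from the potential. -/
theorem structureCoeff_of_noOne {x y : V} {r : Chain (Gen V) x y} (hr : Gen.NoOne r)
    {u : Gen V x y} (hu : u.deg < 3) : W.structureCoeff r u = W.contract r u := by
  rcases r with _ | ⟨f, _ | ⟨g, _ | _⟩⟩ <;> try rfl
  rw [structureCoeff_pair, Gen.comp_eq_zero hr.deg_pos
    (Gen.NoOne.right (p := .cons f (.nil _)) hr).deg_pos hu, zero_add]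

theorem structureCoeff_nil {x : V} (h : Gen V x x) : W.structureCoeff (.nil x) h = 0 :=
  W.contract_nil h

end Potential
/-! ### Multilinear extension -/

/-- A multilinear extension may be evaluated on the right piece first. -/
theorem multExt_append {x y z : V}
    (p : Chain (fun x y : V => Σ d : ℤ, GenSpace k x y d) y z)
    (q : Chain (fun x y : V => Σ d : ℤ, GenSpace k x y d) x y) (F : Chain (Gen V) x z → k) :
    multExt (p.append q) F = multExt q fun q' => multExt p fun p' => F (p'.append q') := by
  induction p with
  | nil => rfl
  | cons v p ih => exact ih _

theorem multExt_zero {x y : V} (p : Chain (fun x y : V => Σ d : ℤ, GenSpace k x y d) x y) :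
    multExt p (fun _ => 0) = 0 := by
  simpa using multExt_smul_fun p 0 fun _ => 0

theorem multExt_finsupp_sum {x y : V}
    (p : Chain (fun x y : V => Σ d : ℤ, GenSpace k x y d) x y) {ι : Type*} (v : ι →₀ k)
    (F : ι → Chain (Gen V) x y → k) :
    multExt p (fun q => v.sum fun i c => c * F i q) = v.sum fun i c => c * multExt p (F i) := by
  induction v using Finsupp.induction_linear with
  | zero => simpa using multExt_zero p
  | add v w hv hw =>
    have h : ∀ G : ι → k, (v + w).sum (fun i c => c * G i) =
        v.sum (fun i c => c * G i) + w.sum fun i c => c * G i := fun G =>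
      Finsupp.sum_add_index' (fun _ => zero_mul _) fun _ _ _ => add_mul _ _ _
    simp only [h, multExt_add_fun, hv, hw]
  | single i c =>
    have h : ∀ G : ι → k, (Finsupp.single i c).sum (fun i c => c * G i) = c * G i := fun G =>
      Finsupp.sum_single_index (zero_mul _)
    simp only [h, multExt_smul_fun]

section Dr

variable [∀ x y : V, Finite (x ⟶ y)] {W : Potential k V}

/-- Only sequences of the same length and degree contribute to the multilinear extension. -/
theorem multExt_congr {x y : V} (p : Chain (Dr W).El x y) {F G : Chain (Gen V) x y → k}
    (h : ∀ q, q.length = p.length → Gen.sdeg q = (Dr W).sdeg p → F q = G q) :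
    multExt p F = multExt p G := by
  induction p with
  | nil => exact h _ rfl rfl
  | cons v p ih =>
    refine ih fun q hq hd => Finsupp.sum_congr fun g _ => ?_
    rw [h _ (by simp [hq])]
    rw [Gen.sdeg, hd, g.2]
    rfl

/-- The sequence of basis vectors given by a sequence of basis elements. -/
noncomputable def basisChain (W : Potential k V) {x : V} :
    {y : V} → Chain (Gen V) x y → Chain (Dr W).El x y
  | _, .nil _ => .nil x
  | _, .cons g p => .cons ⟨g.deg, (Finsupp.single ⟨g, rfl⟩ 1 : GenSpace k _ _ g.deg)⟩
      (basisChain W p)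

theorem basisChain_append {x y z : V} (p : Chain (Gen V) y z) (q : Chain (Gen V) x y) :
    basisChain W (p.append q) = (basisChain W p).append (basisChain W q) := by
  induction p with
  | nil => rfl
  | cons g p ih => simp [basisChain, ih]

theorem sdeg_basisChain {x y : V} (p : Chain (Gen V) x y) :
    (Dr W).sdeg (basisChain W p) = Gen.sdeg p := by
  induction p with
  | nil => rfl
  | cons g p ih => rw [basisChain, GradedFamily.sdeg_cons, ih]; rfl

theorem splits_basisChain {x y : V} (p : Chain (Gen V) x y) :
    (basisChain W p).splits =
      p.splits.map fun s => ⟨s.1, basisChain W s.2.1, basisChain W s.2.2⟩ := by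
  induction p with
  | nil => rfl
  | cons g p ih => simp [basisChain, Chain.splits, ih, Function.comp_def]

theorem multExt_basisChain {x y : V} (p : Chain (Gen V) x y) (F : Chain (Gen V) x y → k) :
    multExt (basisChain W p) F = F p := by
  induction p with
  | nil => rfl
  | cons g p ih =>
    refine (ih _).trans ?_
    exact (Finsupp.sum_single_index (zero_mul _)).trans (one_mul _)

/-- The `A_∞`-relations hold as soon as they hold on basis vectors. -/
theorem relation_of_basisChain
    (h : ∀ {x y : V} (r : Chain (Gen V) x y) (e : ℤ), (Dr W).relation (basisChain W r) e = 0)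
    {x y : V} (p : Chain (Dr W).El x y) (e : ℤ) : (Dr W).relation p e = 0 := by
  suffices H : ∀ {z : V} (r : Chain (Gen V) y z),
      (Dr W).relation ((basisChain W r).append p) e = 0 from H (.nil y)
  induction p with
  | nil => intro z r; rw [Chain.append_nil]; exact h r e
  | cons f p ih =>
    intro z r
    obtain ⟨d, v⟩ := f
    change GenSpace k _ _ d at v
    induction v using Finsupp.induction_linear with
    | zero =>
      rw [AInfData.relation_append_cons]
      have := (Dr W).diag.relation_smul (basisChain W r) d 0 0 p e
      rw [zero_smul, zero_smul] at this
      exact this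
    | add v w hv hw =>
      rw [AInfData.relation_append_cons] at hv hw ⊢
      refine ((Dr W).diag.relation_add (basisChain W r) d v w p e).trans ?_
      exact (congrArg₂ _ hv hw).trans (add_zero _)
    | single g c =>
      obtain ⟨g, rfl⟩ := g
      have h1 := ih (r.append (.cons g (.nil _)))
      rw [basisChain_append, Chain.append_assoc] at h1
      have h2 := (AInfData.relation_append_cons _ _ _ _).symm.trans h1
      have h3 := (Dr W).diag.relation_smul (basisChain W r) g.deg c
        (Finsupp.single ⟨g, rfl⟩ 1 : GenSpace k _ _ g.deg) p e
      rw [AInfData.relation_append_cons]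
      rw [show (Dr W).diag.relation (basisChain W r)
        ⟨g.deg, (Finsupp.single ⟨g, rfl⟩ 1 : GenSpace k _ _ g.deg)⟩ p e = 0 from h2, smul_zero] at h3
      refine Eq.trans ?_ h3
      congr 2
      exact ((Finsupp.smul_single c _ _).trans (by rw [smul_eq_mul, mul_one])).symm

/-! ### The category -/

theorem Dr_nil (x : V) (e : ℤ) : (Dr W).b (.nil x) e = 0 :=
  Finsupp.ext fun h => W.structureCoeff_nil h.1

theorem Dr_degree {x y : V} (p : Chain (Dr W).El x y) (e : ℤ) (he : e ≠ (Dr W).sdeg p + 2) :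
    (Dr W).b p e = 0 := by
  refine Finsupp.ext fun h => ?_
  refine (multExt_congr p fun q _ hq => ?_).trans (multExt_zero p)
  exact W.structureCoeff_of_degree_ne q h.1 (by rw [hq, h.2]; exact he)

theorem Dr_one_left {x y : V} (d : ℤ) (f : (Dr W).obj x y d) :
    (Dr W).b (.cons ⟨0, (Dr W).one y⟩ (.cons ⟨d, f⟩ (.nil x))) d = f := by
  change GenSpace k x y d at f
  refine Finsupp.ext fun h => ?_
  change f.sum (fun g c => c * (Finsupp.single ⟨Gen.one y, rfl⟩ 1 : GenSpace k y y 0).sum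
    fun g' c' => c' * W.structureCoeff (.cons g'.1 (.cons g.1 (.nil x))) h.1) = f h
  have : ∀ g : {g : Gen V x y // g.deg = d},
      (Finsupp.single ⟨Gen.one y, rfl⟩ 1 : GenSpace k y y 0).sum
        (fun g' c' => c' * W.structureCoeff (.cons g'.1 (.cons g.1 (.nil x))) h.1) =
      if h = g then 1 else 0 := by
    intro g
    rw [Finsupp.sum_single_index (zero_mul _), one_mul, Potential.structureCoeff_pair,
      Potential.contract_of_word_eq_none _ _ rfl, add_zero]
    simp [Gen.comp, Subtype.ext_iff]
  simp only [this]
  rw [Finsupp.sum_eq_single h (fun g _ hg => by rw [if_neg hg.symm, mul_zero]) (by simp),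
    if_pos rfl, mul_one]

theorem Dr_one_right {x y : V} (d : ℤ) (f : (Dr W).obj x y d) :
    (Dr W).b (.cons ⟨d, f⟩ (.cons ⟨0, (Dr W).one x⟩ (.nil x))) d = sgn k d • f := by
  change GenSpace k x y d at f
  refine Finsupp.ext fun h => ?_
  change (Finsupp.single ⟨Gen.one x, rfl⟩ 1 : GenSpace k x x 0).sum (fun g' c' => c' *
    f.sum fun g c => c * W.structureCoeff (.cons g.1 (.cons g'.1 (.nil x))) h.1) = sgn k d * f h
  rw [Finsupp.sum_single_index (zero_mul _), one_mul]
  have : ∀ g : {g : Gen V x y // g.deg = d},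
      W.structureCoeff (.cons g.1 (.cons (Gen.one x) (.nil x))) h.1 =
        if h = g then sgn k d else 0 := by
    rintro ⟨g, rfl⟩
    have hw := Gen.word_eq_none (.cons g (.nil x)) (u := Gen.one x) (by simp [Gen.deg]) (.nil x)
    simp only [Chain.cons_append, Chain.nil_append] at hw
    rw [Potential.structureCoeff_pair, Potential.contract_of_word_eq_none _ _ hw, add_zero]
    rw [Gen.comp_one_right]
    exact if_congr ⟨fun h' => Subtype.ext h', congrArg Subtype.val⟩ rfl rfl
  simp only [this]
  rw [Finsupp.sum_eq_single h (fun g _ hg => by rw [if_neg hg.symm, mul_zero]) (by simp),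
    if_pos rfl, mul_comm]

theorem Dr_one_vanish {x y z : V} (p : Chain (Dr W).El y z) (q : Chain (Dr W).El x y) (e : ℤ)
    (hl : p.length + q.length ≠ 1) :
    (Dr W).b (p.append (.cons ⟨0, (Dr W).one y⟩ q)) e = 0 := by
  refine Finsupp.ext fun h => (multExt_append p _ _).trans ?_
  refine Eq.trans (multExt_congr q fun q' hq' _ => ?_) (multExt_zero q)
  refine (Finsupp.sum_single_index (zero_mul _)).trans ?_
  rw [one_mul]
  refine Eq.trans (multExt_congr p fun p' hp' _ => ?_) (multExt_zero p)
  rw [Potential.structureCoeff_of_length_ne, Potential.contract_of_word_eq_none]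
  · exact Gen.word_eq_none p' (by simp [Gen.deg]) q'
  · simp only [Chain.length_append, Chain.length_cons]; omega

/-- If a single basis element `u₀` contributes, it determines the value of an operation one of whose
inputs is the output of an operation on basis vectors. -/
theorem Dr_b_bEl_apply {x y z t : V} (r₁ : Chain (Gen V) z t) (r₂ : Chain (Gen V) y z)
    (r₃ : Chain (Gen V) x y) (e : ℤ) (h : {g : Gen V x t // g.deg = e}) (u₀ : Gen V y z)
    (hu₀ : ∀ u, u ≠ u₀ →
      W.structureCoeff r₂ u * W.structureCoeff (r₁.append (.cons u r₃)) h.1 = 0) :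
    DFunLike.coe (F := GenSpace k x t e) ((Dr W).b ((basisChain W r₁).append
      (.cons ((Dr W).bEl (basisChain W r₂)) (basisChain W r₃))) e) h =
    W.structureCoeff r₂ u₀ * W.structureCoeff (r₁.append (.cons u₀ r₃)) h.1 := by
  have hd : ∀ u : Gen V y z, u.deg ≠ (Dr W).sdeg (basisChain W r₂) + 2 →
      W.structureCoeff r₂ u = 0 := fun u hu =>
    W.structureCoeff_of_degree_ne r₂ u (by rwa [← sdeg_basisChain (W := W)])
  have hE : ∀ (d : ℤ) (E : GenSpace k y z d), (∀ u, E u = W.structureCoeff r₂ u.1) →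
      (∀ u : Gen V y z, u.deg ≠ d → W.structureCoeff r₂ u = 0) →
      multExt (.cons ⟨d, E⟩ (basisChain W r₃))
        (fun q => multExt (basisChain W r₁) fun p => W.structureCoeff (p.append q) h.1) =
      W.structureCoeff r₂ u₀ * W.structureCoeff (r₁.append (.cons u₀ r₃)) h.1 := by
    intro d E hE hd
    refine (multExt_basisChain r₃ _).trans ?_
    have hs : ∀ u : {u : Gen V y z // u.deg = d},
        multExt (basisChain W r₁) (fun p => W.structureCoeff (p.append (.cons u.1 r₃)) h.1) =
        W.structureCoeff (r₁.append (.cons u.1 r₃)) h.1 := fun u => multExt_basisChain r₁ _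
    simp only [hs]
    by_cases hu : u₀.deg = d
    · rw [Finsupp.sum_eq_single ⟨u₀, hu⟩ _ (by simp), hE]
      intro u _ hu'
      rw [hE]
      exact hu₀ u.1 fun h' => hu' (Subtype.ext h')
    · rw [hd u₀ hu, zero_mul]
      refine Finset.sum_eq_zero fun u _ => ?_
      dsimp only
      rw [hE]
      refine hu₀ u.1 ?_
      rintro rfl
      exact hu u.2
  exact (multExt_append (basisChain W r₁) _ _).trans
    (hE _ _ (fun u => multExt_basisChain r₂ _) hd)

theorem Dr_b_bEl_eq_zero {x y z t : V} (r₁ : Chain (Gen V) z t) (r₂ : Chain (Gen V) y z)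
    (r₃ : Chain (Gen V) x y) (e : ℤ) (h : {g : Gen V x t // g.deg = e})
    (hu : ∀ u, W.structureCoeff r₂ u * W.structureCoeff (r₁.append (.cons u r₃)) h.1 = 0) :
    DFunLike.coe (F := GenSpace k x t e) ((Dr W).b ((basisChain W r₁).append
      (.cons ((Dr W).bEl (basisChain W r₂)) (basisChain W r₃))) e) h = 0 := by
  by_cases hne : Nonempty (Gen V y z)
  · exact (Dr_b_bEl_apply r₁ r₂ r₃ e h hne.some fun u _ => hu u).trans (hu _)
  · refine (multExt_append (basisChain W r₁) _ _).trans ((multExt_basisChain r₃ _).trans ?_)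
    exact Finset.sum_eq_zero fun u _ => absurd ⟨u.1⟩ hne

omit [∀ x y : V, Finite (x ⟶ y)] in
/-- An outer operation with other than two inputs does not accept the output of an inner one: it
only accepts dual arrows, and the inner one yields arrows and multiples of the `ω_x`. -/
theorem structureCoeff_mul_eq_zero {x y z t : V} {r₁ : Chain (Gen V) z t} {r₂ : Chain (Gen V) y z}
    {r₃ : Chain (Gen V) x y} (hr : Gen.NoOne r₂) (hl : r₁.length + r₃.length ≠ 1) (u : Gen V y z)
    (h : Gen V x t) :
    W.structureCoeff r₂ u * W.structureCoeff (r₁.append (.cons u r₃)) h = 0 := by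
  by_cases hu : u.deg = 2
  · rw [W.structureCoeff_of_length_ne (r₁.append (.cons u r₃)),
      W.contract_of_word_eq_none _ (Gen.word_eq_none r₁ (by omega) r₃), mul_zero]
    simp only [Chain.length_append, Chain.length_cons]; omega
  · by_cases hu' : u.deg < 3
    · rw [W.structureCoeff_of_noOne hr hu', W.contract_of_deg_ne_two _ hu, zero_mul]
    · rw [W.structureCoeff_of_length_ne (r₁.append (.cons u r₃)),
        W.contract_of_word_eq_none _ (Gen.word_eq_none r₁ (by omega) r₃), mul_zero]
      simp only [Chain.length_append, Chain.length_cons]; omega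

/-- Composing the output of an operation with a basis element on the right. -/
theorem Dr_b_bEl_left {x y z : V} {r : Chain (Gen V) y z} (hr : Gen.NoOne r) {g : Gen V x y}
    (hg : 0 < g.deg) (e : ℤ) (h : {h : Gen V x z // h.deg = e}) :
    DFunLike.coe (F := GenSpace k x z e) ((Dr W).b (.cons ((Dr W).bEl (basisChain W r))
      (basisChain W (.cons g (.nil x)))) e) h =
    if h.1.deg = 3 then W.pathCoeff (r.append (.cons g (.nil x))) else 0 := by
  obtain ⟨h, rfl⟩ := h
  have key : ∀ u, 2 ≤ u.deg → W.structureCoeff (.cons u (.cons g (.nil x))) h =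
      Gen.comp u g h := by
    intro u hu
    have hw := Gen.word_eq_none (.nil z) (u := u) (by omega) (.cons g (.nil x))
    rw [Chain.nil_append] at hw
    rw [W.structureCoeff_pair, W.contract_of_word_eq_none _ hw, add_zero]
  have key' : ∀ u : Gen V y z, u.deg < 2 → W.structureCoeff r u = 0 := by
    intro u hu
    rw [W.structureCoeff_of_noOne hr (by omega), W.contract_of_deg_ne_two _ (by omega)]
  by_cases hh : h.deg = 3
  · rw [if_pos hh]
    cases h with
    | omega =>
      refine (Dr_b_bEl_apply (.nil _) r (.cons g (.nil x)) _ _ g.swap ?_).trans ?_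
      rotate_left
      · by_cases hu : g.swap.deg < 2
        · rw [key' _ hu, zero_mul, ← W.contract_swap, W.contract_of_deg_ne_two _ (by omega)]
        · have := Gen.deg_swap g
          simp only [Chain.nil_append]
          rw [key _ (by omega), Gen.comp_omega_left (by omega) hg, if_pos rfl, mul_one,
            W.structureCoeff_of_noOne hr (by omega), W.contract_swap]
      · intro u hu
        by_cases hu' : u.deg < 2
        · rw [key' _ hu', zero_mul]
        · simp only [Chain.nil_append]
          rw [key _ (by omega), Gen.comp_omega_left (by omega) hg, if_neg hu, mul_zero]
    | _ => simp [Gen.deg] at hh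
  · rw [if_neg hh]
    refine Dr_b_bEl_eq_zero (.nil _) r (.cons g (.nil x)) _ _ fun u => ?_
    by_cases hu' : u.deg < 2
    · rw [key' _ hu', zero_mul]
    · have := h.deg_mem
      simp only [Chain.nil_append]
      rw [key _ (by omega), Gen.comp_eq_zero (by omega) hg (by have := this.2; omega), mul_zero]

/-- Composing the output of an operation with a basis element on the left. -/
theorem Dr_b_bEl_right {x y z : V} {r : Chain (Gen V) x y} (hr : Gen.NoOne r) {f : Gen V y z}
    (hf : 0 < f.deg) (e : ℤ) (h : {h : Gen V x z // h.deg = e}) :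
    DFunLike.coe (F := GenSpace k x z e) ((Dr W).b ((basisChain W (.cons f (.nil y))).append
      (.cons ((Dr W).bEl (basisChain W r)) (.nil x))) e) h =
    if h.1.deg = 3 then -W.pathCoeff (.cons f r) else 0 := by
  obtain ⟨h, rfl⟩ := h
  have key : ∀ u, 2 ≤ u.deg → W.structureCoeff (.cons f (.cons u (.nil x))) h =
      Gen.comp f u h := by
    intro u hu
    have hw := Gen.word_eq_none (.cons f (.nil y)) (u := u) (by omega) (.nil x)
    rw [Chain.cons_append, Chain.nil_append] at hw
    rw [W.structureCoeff_pair, W.contract_of_word_eq_none _ hw, add_zero]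
  have key' : ∀ u : Gen V x y, u.deg < 2 → W.structureCoeff r u = 0 := by
    intro u hu
    rw [W.structureCoeff_of_noOne hr (by omega), W.contract_of_deg_ne_two _ (by omega)]
  by_cases hh : h.deg = 3
  · rw [if_pos hh]
    cases h with
    | omega =>
      refine (Dr_b_bEl_apply (.cons f (.nil y)) r (.nil _) _ _ f.swap ?_).trans ?_
      rotate_left
      · rw [W.pathCoeff_rotate]
        by_cases hu : f.swap.deg < 2
        · rw [key' _ hu, zero_mul, ← W.contract_swap, W.contract_of_deg_ne_two _ (by omega),
            neg_zero]
        · have := Gen.deg_swap f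
          simp only [Chain.cons_append, Chain.nil_append]
          rw [key _ (by omega), Gen.comp_omega_right hf (by omega), if_pos rfl, mul_neg_one,
            W.structureCoeff_of_noOne hr (by omega), W.contract_swap]
      · intro u hu
        by_cases hu' : u.deg < 2
        · rw [key' _ hu', zero_mul]
        · simp only [Chain.cons_append, Chain.nil_append]
          rw [key _ (by omega), Gen.comp_omega_right hf (by omega), if_neg hu, mul_zero]
    | _ => simp [Gen.deg] at hh
  · rw [if_neg hh]
    refine Dr_b_bEl_eq_zero (.cons f (.nil y)) r (.nil _) _ _ fun u => ?_
    by_cases hu' : u.deg < 2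
    · rw [key' _ hu', zero_mul]
    · have := h.deg_mem
      simp only [Chain.cons_append, Chain.nil_append]
      rw [key _ (by omega), Gen.comp_eq_zero hf (by omega) (by have := this.2; omega), mul_zero]

/-! ### The relations without identities -/

/-- Without identities, only the outermost compositions contribute to the `A_∞`-relation, and they
cancel because `μ(W)` is cyclically invariant. -/
theorem relation_basisChain_of_noOne {x y : V} (r : Chain (Gen V) x y) (hr : Gen.NoOne r) (e : ℤ) :
    (Dr W).relation (basisChain W r) e = 0 := by
  have hz : ∀ {z t : V} (r₁ : Chain (Gen V) z y) (r₂ : Chain (Gen V) t z)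
      (r₃ : Chain (Gen V) x t), Gen.NoOne r₂ → r₁.length + r₃.length ≠ 1 →
      (Dr W).b ((basisChain W r₁).append (.cons ((Dr W).bEl (basisChain W r₂))
        (basisChain W r₃))) e = 0 := fun r₁ r₂ r₃ h₂ hl =>
    Finsupp.ext fun h => Dr_b_bEl_eq_zero r₁ r₂ r₃ e h fun u =>
      structureCoeff_mul_eq_zero h₂ hl u h.1
  have hnil : ∀ {z : V} (r₁ : Chain (Gen V) z y) (r₃ : Chain (Gen V) x z),
      (Dr W).b ((basisChain W r₁).append (.cons ((Dr W).bEl (basisChain W (.nil z)))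
        (basisChain W r₃))) e = 0 := fun r₁ r₃ =>
    Finsupp.ext fun h => Dr_b_bEl_eq_zero r₁ (.nil _) r₃ e h fun u => by
      rw [W.structureCoeff_nil, zero_mul]
  have hrel : (Dr W).relation (basisChain W r) e =
      (r.splits.map fun s => (s.2.2.splits.map fun t => sgn k ((Dr W).sdeg (basisChain W s.2.1)) •
        (Dr W).b ((basisChain W s.2.1).append (.cons ((Dr W).bEl (basisChain W t.2.1))
        (basisChain W t.2.2))) e).sum).sum := by
    rw [AInfData.relation, splits_basisChain, List.map_map]
    refine congrArg List.sum (congrArg (List.map · _) (funext fun s => ?_))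
    rw [Function.comp, splits_basisChain, List.map_map]
    rfl
  rw [hrel]
  clear hrel
  induction r using Chain.snoc_cases with
  | nil =>
    simp only [Chain.splits, List.map_cons, List.map_nil, List.sum_singleton]
    rw [hnil (.nil _) (.nil _), smul_zero]
  | snoc r g =>
    rcases r with _ | ⟨f, r⟩
    · refine Chain.sum_splits_eq_zero _ _ fun s hs => Chain.sum_splits_eq_zero _ _ fun t ht => ?_
      obtain ⟨z, t₁, t₂⟩ := t
      cases t₁ with
      | nil => rw [hnil, smul_zero]
      | cons f' t₁ =>
        rw [← ht] at hs
        have hl := congrArg Chain.length hs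
        simp only [Chain.length_append, Chain.length_cons, Chain.length_nil] at hl
        rw [hz, smul_zero]
        · rw [← hs] at hr
          exact hr.right.left
        · dsimp only
          omega
    have hsplit : ((Chain.cons f r).append (.cons g (.nil _))).splits =
        ⟨_, .nil _, (Chain.cons f r).append (.cons g (.nil _))⟩ ::
        (r.append (.cons g (.nil _))).splits.map fun s => ⟨s.1, .cons f s.2.1, s.2.2⟩ := rfl
    rw [hsplit, List.map_cons, List.sum_cons, List.map_map]
    -- The terms in which the inner operation takes all inputs but the last.
    have h₁ : (((Chain.cons f r).append (.cons g (.nil _))).splits.map fun t =>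
        sgn k 0 •
          (Dr W).b ((basisChain W (.nil _)).append (.cons ((Dr W).bEl (basisChain W t.2.1))
            (basisChain W t.2.2))) e).sum =
        (Dr W).b (.cons ((Dr W).bEl (basisChain W (.cons f r)))
          (basisChain W (.cons g (.nil _)))) e := by
      rw [Chain.splits_append_cons, List.map_append, List.sum_append, List.map_map, List.map_map,
        Chain.sum_splits_of_right]
      · simp only [Chain.splits, Function.comp, List.map_cons, List.map_nil, List.sum_singleton]
        rw [hz (.nil _) _ (.nil _) hr (by simp), smul_zero, add_zero,
          sgn_of_even k (by decide), one_smul]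
        rfl
      · intro s hs hl
        simp only [Function.comp]
        rw [hz, smul_zero]
        · have := hr.left
          rw [← hs] at this
          exact this.left
        · simpa using hl
    -- The terms in which the inner operation takes all inputs but the first.
    have h₂ : ((r.append (.cons g (.nil _))).splits.map fun s => (s.2.2.splits.map fun t =>
        sgn k ((Dr W).sdeg (basisChain W (.cons f s.2.1))) •
          (Dr W).b ((basisChain W (.cons f s.2.1)).append
            (.cons ((Dr W).bEl (basisChain W t.2.1)) (basisChain W t.2.2))) e).sum).sum =
        sgn k (f.deg - 1) • (Dr W).b ((basisChain W (.cons f (.nil _))).append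
          (.cons ((Dr W).bEl (basisChain W (r.append (.cons g (.nil _))))) (.nil _))) e := by
      have hr' : Gen.NoOne (r.append (.cons g (.nil _))) :=
        Gen.NoOne.right (p := .cons f (.nil _)) hr
      rw [Chain.sum_splits_of_left, Chain.sum_splits_of_right]
      · rw [sdeg_basisChain, Gen.sdeg, Gen.sdeg, add_zero]
        rfl
      · intro t ht hl
        rw [hz, smul_zero]
        · dsimp only at ht
          rw [← ht] at hr'
          exact hr'.left
        · simpa using hl
      · intro s hs hl
        refine Chain.sum_splits_eq_zero _ _ fun t ht => ?_
        rw [hz, smul_zero]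
        · rw [← hs, ← ht] at hr'
          exact hr'.right.left
        · simp only [Chain.length_cons]; omega
    refine (congrArg₂ _ h₁ h₂).trans (Finsupp.ext fun h => ?_)
    have hf : 0 < f.deg := Gen.NoOne.deg_pos hr
    have hg : 0 < g.deg := hr.right.deg_pos
    have hr₁ : Gen.NoOne (.cons f r) := hr.left
    have hr₂ : Gen.NoOne (r.append (.cons g (.nil _))) :=
      Gen.NoOne.right (p := .cons f (.nil _)) hr
    refine (congrArg₂ (fun a b => a + sgn k (f.deg - 1) * b)
      (Dr_b_bEl_left hr₁ hg e h) (Dr_b_bEl_right hr₂ hf e h)).trans ?_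
    refine Eq.trans (b := (0 : k)) ?_ rfl
    split_ifs with hh
    · rw [Chain.cons_append]
      cases f with
      | star a => simp [Gen.deg, sgn_of_even k (n := 0) (by decide)]
      | _ => simp [Potential.pathCoeff, Gen.word]
    · simp

theorem Dr_isAInfCategory : (Dr W).IsAInfCategory where
  nil := Dr_nil
  degree := Dr_degree
  relation := by
    refine relation_of_basisChain fun {x y} r e => ?_
    by_cases hr : Gen.NoOne r
    · exact relation_basisChain_of_noOne r hr e
    · simp only [Gen.NoOne, not_forall, not_not] at hr
      obtain ⟨z, p, q, rfl⟩ := hr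
      rw [basisChain_append]
      exact AInfData.relation_unit Dr_one_left Dr_one_right Dr_one_vanish Dr_degree _ _ e
  one_left := Dr_one_left
  one_right := Dr_one_right
  one_vanish := Dr_one_vanish

theorem Dr_finiteDimensional (x y : V) (d : ℤ) : FiniteDimensional k ((Dr W).obj x y d) :=
  inferInstanceAs (FiniteDimensional k (GenSpace k x y d))

theorem Dr_isFiniteDimensional [Finite V] : (Dr W).IsFiniteDimensional := by
  refine ⟨inferInstance, fun x y => ⟨Dr_finiteDimensional x y, ?_⟩⟩
  refine (Set.finite_Icc (0 : ℤ) 3).subset fun d hd => ?_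
  by_contra h
  have : IsEmpty {g : Gen V x y // g.deg = d} := ⟨fun g => h (by rw [← g.2]; exact g.1.deg_mem)⟩
  have hd' : Nontrivial (GenSpace k x y d) := hd
  exact not_subsingleton (GenSpace k x y d) inferInstance

/-! ### The Calabi–Yau structure -/

/-- The pairing with a basis element reads off the coefficient of the dual basis element. -/
theorem drPairing_apply (x y : V) (d e : ℤ) (f : GenSpace k x y d) (g : GenSpace k y x e) :
    drPairing W x y d e f g = g.sum fun h c =>
      c * if hd : h.1.swap.deg = d then f ⟨h.1.swap, hd⟩ else 0 := by
  change (Finsupp.linearCombination k fun g : {g : Gen V x y // g.deg = d} =>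
    Finsupp.linearCombination k fun h : {h : Gen V y x // h.deg = e} =>
      if h.1 = g.1.swap then (1 : k) else 0) f g = _
  induction f using Finsupp.induction_linear with
  | zero => simp
  | add f f' hf hf' =>
    rw [map_add, LinearMap.add_apply, hf, hf', ← Finsupp.sum_add]
    refine Finsupp.sum_congr fun h _ => ?_
    split_ifs <;> simp [mul_add]
  | single a c =>
    rw [Finsupp.linearCombination_single, LinearMap.smul_apply, Finsupp.linearCombination_apply,
      smul_eq_mul, Finsupp.mul_sum]
    refine Finsupp.sum_congr fun h _ => ?_
    by_cases ha : h.1 = a.1.swap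
    · have ha' : a.1 = h.1.swap := (Gen.eq_swap_iff _ _).1 ha
      have hd : h.1.swap.deg = d := by rw [← ha', a.2]
      rw [if_pos ha, dif_pos hd, Finsupp.single_apply, if_pos (Subtype.ext ha')]
      simp [mul_comm]
    · rw [if_neg ha]
      split_ifs with hd
      · rw [Finsupp.single_apply, if_neg]
        · simp
        · intro h'
          exact ha ((Gen.eq_swap_iff _ _).2 (congrArg Subtype.val h'))
      · simp

theorem drPairing_single_right (x y : V) (d : ℤ) (f : GenSpace k x y d)
    (a : {g : Gen V x y // g.deg = d}) (e : ℤ) (he : a.1.swap.deg = e) :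
    drPairing W x y d e f (Finsupp.single ⟨a.1.swap, he⟩ 1 : GenSpace k y x e) = f a := by
  refine (drPairing_apply x y d e f _).trans ((Finsupp.sum_single_index (zero_mul _)).trans ?_)
  have hs : a.1.swap.swap = a.1 := a.1.swap_swap
  rw [one_mul, dif_pos (by rw [hs]; exact a.2)]
  congr 1
  exact Subtype.ext hs

theorem drPairing_of_degree_ne (x y : V) (d e : ℤ) (h : d + e ≠ 3) : drPairing W x y d e = 0 := by
  refine LinearMap.ext fun f => LinearMap.ext fun g => (drPairing_apply x y d e f g).trans ?_
  refine Finset.sum_eq_zero fun a _ => ?_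
  dsimp only
  rw [dif_neg, mul_zero]
  rw [Gen.deg_swap, a.2]
  omega

theorem drPairing_symm (x y : V) (d e : ℤ) (f : GenSpace k x y d) (g : GenSpace k y x e) :
    drPairing W x y d e f g = sgn k (d * e) * drPairing W y x e d g f := by
  by_cases hde : d + e = 3
  swap
  · rw [drPairing_of_degree_ne _ _ _ _ hde, drPairing_of_degree_ne _ _ _ _ (by omega)]
    exact (mul_zero _).symm
  have hev : Even (d * e) := by
    obtain rfl : e = 3 - d := by omega
    rcases Int.even_or_odd d with h | h
    · exact h.mul_right _
    · exact (Odd.sub_odd (by decide) h).mul_left _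
  rw [sgn_of_even k hev, one_mul]
  induction g using Finsupp.induction_linear with
  | zero =>
    exact (map_zero (drPairing W x y d e f)).trans
      (LinearMap.congr_fun (map_zero (drPairing W y x e d)) f).symm
  | add g g' hg hg' =>
    exact (map_add (drPairing W x y d e f) g g').trans ((congrArg₂ _ hg hg').trans
      (LinearMap.congr_fun (map_add (drPairing W y x e d) g g') f).symm)
  | single a c =>
    refine (drPairing_apply x y d e f _).trans ((Finsupp.sum_single_index (zero_mul _)).trans ?_)
    refine Eq.trans ?_ (drPairing_apply y x e d _ f).symm
    have hd : a.1.swap.deg = d := by rw [Gen.deg_swap, a.2]; omega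
    rw [dif_pos hd, Finsupp.sum_eq_single ⟨a.1.swap, hd⟩ _ (by simp)]
    · have hs : a.1.swap.swap = a.1 := a.1.swap_swap
      rw [dif_pos (by rw [hs]; exact a.2), Finsupp.single_apply, if_pos (Subtype.ext hs.symm),
        mul_comm]
    · intro b _ hb
      split_ifs with hb'
      · rw [Finsupp.single_apply, if_neg, mul_zero]
        intro h'
        exact hb (Subtype.ext ((Gen.eq_swap_iff _ _).2 (congrArg Subtype.val h')))
      · rw [mul_zero]

/-- The pairing of an operation with `g`, as a multilinear extension. -/
theorem drPairing_b (x y : V) (p : Chain (Dr W).El x y) (d e : ℤ) (hde : d + e = 3)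
    (g : GenSpace k y x e) : drPairing W x y d e ((Dr W).b p d) g =
      multExt p fun q => g.sum fun h c => c * W.structureCoeff q h.1.swap := by
  refine Eq.trans ?_ (multExt_finsupp_sum p g fun h q => W.structureCoeff q h.1.swap).symm
  refine (drPairing_apply x y d e _ g).trans (Finsupp.sum_congr fun h _ => ?_)
  rw [dif_pos (by rw [Gen.deg_swap, h.2]; omega)]
  rfl

theorem drPairing_cyclic {x y z : V} (f : (Dr W).El y z) (p : Chain (Dr W).El x y)
    (g : (Dr W).El z x) :
    (drPairing W).cyc (.cons f p) g =
      sgn k ((f.1 - 1) * ((Dr W).sdeg p + (g.1 - 1))) *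
        (drPairing W).cyc (p.append (.cons g (.nil z))) f := by
  have hD : (Dr W).sdeg (.cons f p) + 2 = (f.1 - 1) + (Dr W).sdeg p + 2 := rfl
  have hD' : (Dr W).sdeg (p.append (.cons g (.nil z))) + 2 = (Dr W).sdeg p + (g.1 - 1) + 2 := by
    simp only [GradedFamily.sdeg_append, GradedFamily.sdeg_cons, GradedFamily.sdeg_nil, add_zero]
  rw [Pairing.cyc_eq _ _ hD.symm, Pairing.cyc_eq _ _ hD'.symm]
  by_cases h : (f.1 - 1) + (Dr W).sdeg p + 2 + g.1 = 3
  swap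
  · rw [drPairing_of_degree_ne _ _ _ _ h, drPairing_of_degree_ne _ _ _ _ (by omega)]
    simp
  obtain ⟨df, f⟩ := f
  obtain ⟨dg, g⟩ := g
  change GenSpace k y z df at f
  change GenSpace k z x dg at g
  dsimp only at h ⊢
  rw [drPairing_b _ _ _ _ _ h, drPairing_b _ _ _ _ _ (by omega)]
  refine Eq.trans ?_ (congrArg (fun v => sgn k ((df - 1) * ((Dr W).sdeg p + (dg - 1))) *
    (sgn k ((Dr W).sdeg p + (dg - 1) + 2) * v)) (multExt_append p _ _)).symm
  change _ * multExt p (fun q => f.sum fun a c => c * g.sum fun h c' =>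
    c' * W.structureCoeff (.cons a.1 q) h.1.swap) = _ * (_ * g.sum fun h c => c *
      multExt p fun q => f.sum fun a c' => c' *
        W.structureCoeff (q.append (.cons h.1 (.nil z))) a.1.swap)
  refine Eq.trans (multExt_smul_fun p _ _).symm (Eq.trans ?_ (congrArg (fun v => _ * (_ * v))
    (multExt_finsupp_sum p g fun h q => f.sum fun a c' => c' *
      W.structureCoeff (q.append (.cons h.1 (.nil z))) a.1.swap)))
  refine Eq.trans ?_ (congrArg (_ * ·) (multExt_smul_fun p _ _))
  refine Eq.trans ?_ (multExt_smul_fun p _ _)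
  refine multExt_congr p fun q _ hq => ?_
  simp only [Finsupp.mul_sum]
  rw [Finsupp.sum_comm]
  refine Finsupp.sum_congr fun b _ => Finsupp.sum_congr fun a _ => ?_
  have := W.structureCoeff_cyclic a.1 q b.1
  rw [a.2, b.2, hq] at this
  linear_combination (f a) * (g b) * this

theorem drPairing_isCalabiYau : (drPairing W).IsCalabiYau where
  degree := drPairing_of_degree_ne
  symm := drPairing_symm
  nondegenerate x y d f hf := by
    refine Finsupp.ext fun a => ?_
    exact (drPairing_single_right x y d f a (3 - d) (by rw [Gen.deg_swap, a.2])).symm.trans (hf _)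
  cyclic := drPairing_cyclic

end Dr
/-! ### The Lagrangian sub-bimodule -/

theorem Gen.inL_swap (T : Set (Quiver.Total V)) {x y : V} (g : Gen V x y) :
    g.swap.InL T ↔ ¬g.InL T := by
  cases g <;> simp [Gen.swap, Gen.InL]

/-- A cycle of `W` does not traverse two (possibly equal) arrows of `T`. -/
theorem Potential.mu_eq_zero_of_mem {W : Potential k V} {T : Set (Quiver.Total V)}
    (hT : W.MeetsAtMostOnce T) {a c : Quiver.Total V} (ha : a ∈ T) (hc : c ∈ T)
    {l : List (Quiver.Total V)} (hl : a ∈ l) : W.mu (l ++ [c]) = 0 := by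
  rw [Potential.mu]
  by_contra h
  obtain ⟨h₁, h₂⟩ := hT _ (left_ne_zero_of_mul h)
  have hac : a = c := h₁ a ha c hc (by simp [hl]) (by simp)
  subst hac
  -- now `a` occurs twice: once in `l` and once as the last arrow
  have h₃ := h₂ a ha
  rw [Cycle.coe_toMultiset, Multiset.coe_count, List.count_append] at h₃
  have := List.count_pos_iff.2 hl
  simp at h₃
  omega

/-- No operation with an input in `L_T` has an output outside of `L_T`. -/
theorem Potential.structureCoeff_of_inL {W : Potential k V} {T : Set (Quiver.Total V)}
    (hT : W.MeetsAtMostOnce T) {x y z t : V} (p : Chain (Gen V) z t) {g : Gen V y z}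
    (q : Chain (Gen V) x y) {h : Gen V x t} (hg : g.InL T) (hh : ¬h.InL T) :
    W.structureCoeff (p.append (.cons g q)) h = 0 := by
  have hc : W.contract (p.append (.cons g q)) h = 0 := by
    by_cases hg' : g.deg = 1
    swap
    · exact W.contract_of_word_eq_none _ (Gen.word_eq_none p hg' q) h
    cases h with
    | arr c =>
      cases g with
      | star a =>
        simp only [contract, Gen.word_append, Gen.word]
        cases Gen.word p <;> cases Gen.word q <;> simp
        rename_i l₁ l₂
        have := mu_eq_zero_of_mem hT (a := ⟨_, _, a⟩) (c := ⟨_, _, c⟩) hg (by simpa [Gen.InL] using hh)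
          (l := l₁ ++ ⟨_, _, a⟩ :: l₂) (by simp)
        simpa using this
      | _ => simp [Gen.deg] at hg'
    | _ => rfl
  by_cases hl : (p.append (.cons g q)).length = 2
  swap
  · rw [W.structureCoeff_of_length_ne _ hl, hc]
  rcases p with _ | ⟨f, _ | _⟩
  · rcases q with _ | ⟨f, _ | _⟩
    · simp at hl
    · simp only [Chain.nil_append] at hc ⊢
      rw [W.structureCoeff_pair, hc, add_zero]
      cases g <;> cases f <;> cases h <;> simp_all [Gen.comp, Gen.InL]
      all_goals
        rintro rfl
        contradiction
    · simp at hl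
  · rcases q with _ | _
    · simp only [Chain.nil_append, Chain.cons_append] at hc ⊢
      rw [W.structureCoeff_pair, hc, add_zero]
      cases g <;> cases f <;> cases h <;> simp_all [Gen.comp, Gen.InL]
      all_goals
        rintro rfl
        contradiction
    · simp at hl
  · simp at hl

section Dr

variable [∀ x y : V, Finite (x ⟶ y)] {W : Potential k V} {T : Set (Quiver.Total V)}

/-- The elements of `L_T` are those without components at the other basis elements. -/
theorem mem_lagSpace_iff {x y : V} {d : ℤ} (f : GenSpace k x y d) :
    f ∈ lagSpace W T x y d ↔ ∀ g, ¬g.1.InL T → f g = 0 := by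
  have hs : {v : GenSpace k x y d | ∃ g : {g : Gen V x y // g.deg = d}, g.1.InL T ∧
      v = Finsupp.single g 1} = (fun g => Finsupp.single g 1) '' {g | g.1.InL T} := by
    ext v; simp [eq_comm]
  change f ∈ Submodule.span k _ ↔ _
  rw [hs, ← Finsupp.supported_eq_span_single, Finsupp.mem_supported']
  rfl

theorem lagSpace_isClosed (hT : W.MeetsAtMostOnce T) :
    (Dr W).diag.IsClosed (lagSpace W T) where
  act_mem {x x' y y'} p q d e m hm := by
    refine (mem_lagSpace_iff _).2 fun h hh => ?_
    refine (multExt_append p (.cons ⟨d, m⟩ q) _).trans ?_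
    change GenSpace k y x d at m
    have hm' := (mem_lagSpace_iff m).1 hm
    change multExt q (fun q' => m.sum fun g c => c * multExt p fun p' =>
      W.structureCoeff (p'.append (.cons g.1 q')) h.1) = 0
    refine Eq.trans (congrArg (multExt q) (funext fun q' => ?_)) (multExt_zero q)
    refine Finset.sum_eq_zero fun g _ => ?_
    dsimp only
    by_cases hg : g.1.InL T
    · have : (fun p' : Chain (Gen V) x x' => W.structureCoeff (p'.append (.cons g.1 q')) h.1) = fun _ => 0 :=
        funext fun p' => Potential.structureCoeff_of_inL hT p' q' hg hh
      rw [this]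
      exact (congrArg (m g * ·) (multExt_zero p)).trans (mul_zero _)
    · rw [hm' g hg, zero_mul]

/-- `L_T` is its own orthogonal complement, because `Gen.swap` exchanges the basis elements in `L_T`
with those outside. -/
theorem mem_lagSpace_iff_orthogonal (x y : V) (d : ℤ) (m : GenSpace k x y d) :
    m ∈ lagSpace W T x y d ↔
      ∀ s ∈ lagSpace W T y x (3 - d), drPairing W x y d (3 - d) m s = 0 := by
  constructor
  · intro hm s hs
    rw [mem_lagSpace_iff] at hm
    change GenSpace k y x (3 - d) at s
    have hs' := (mem_lagSpace_iff s).1 hs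
    refine (drPairing_apply x y d (3 - d) m s).trans (Finset.sum_eq_zero fun h _ => ?_)
    dsimp only
    by_cases hh : h.1.InL T
    · split_ifs with hd
      · rw [hm _ (by rw [Gen.inL_swap]; exact not_not.2 hh), mul_zero]
      · rw [mul_zero]
    · rw [hs' h hh, zero_mul]
  · intro h
    rw [mem_lagSpace_iff]
    intro g hg
    have hd : g.1.swap.deg = 3 - d := by rw [Gen.deg_swap, g.2]
    rw [← drPairing_single_right (W := W) x y d m g (3 - d) hd]
    refine h _ ((mem_lagSpace_iff _).2 fun g' hg' => ?_)
    rw [Finsupp.single_apply, if_neg]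
    rintro rfl
    exact hg' ((Gen.inL_swap T g.1).2 hg)

end Dr
end QP
end AInf

theorem proposition8p2 {k : Type w} [Field k] [CharZero k] {V : Type u} [Finite V] [Quiver.{v} V]
    [∀ x y : V, Finite (x ⟶ y)] (W : AInf.Potential k V) (T : Set (Quiver.Total V))
    (hT : W.MeetsAtMostOnce T) :
    (AInf.Dr W).IsAInfCategory ∧ (AInf.Dr W).IsFiniteDimensional ∧
    (AInf.drPairing W).IsCalabiYau ∧
    ∃ (L : AInf.BimodData.{u, w, max u v w, max u v w} (AInf.Dr W))
      (i : AInf.GrMap L.toGradedFamily (AInf.Dr W).diag.toGradedFamily),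
      AInf.IsLagrangian (AInf.drPairing W) L i ∧
      ∀ x y d, LinearMap.range (i x y d) = AInf.lagSpace W T x y d := by

  refine ⟨AInf.Dr_isAInfCategory, AInf.Dr_isFiniteDimensional, AInf.drPairing_isCalabiYau,
    AInf.BimodData.sub (AInf.lagSpace_isClosed hT), AInf.BimodData.subι (AInf.lagSpace_isClosed hT),
    AInf.isLagrangian_subι AInf.Dr_isAInfCategory AInf.drPairing_isCalabiYau
      AInf.Dr_finiteDimensional _ (AInf.lagSpace_isClosed hT) AInf.mem_lagSpace_iff_orthogonal,
    fun x y d => Submodule.range_subtype _⟩
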